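/- Let $n\ge 0$, $N=2n+2$ and $0\le m<n+1$. Let $V$ be a complex vector space of dimension $N$ with a non-degenerate symmetric bilinear form $(\cdot,\cdot)$, and let $\mathrm{OG}=\mathrm{OG}(m,N)$ be the variety of $m$-dimensional isotropic subspaces of $V$. Let $0=F_0\subsetneq F_1\subsetneq\dots\subsetneq F_N=V$ be an isotropic flag, i.e. a complete flag with $F_i=F_j^\perp$ whenever $i+j=N$, and let $e_1,\dots,e_N$ be a basis of $V$ with $(e_i,e_j)=\delta_{i+j,N+1}$ and $F_p=\langle e_1,\dots,e_p\rangle$ for each $p$. Let $B\subset \mathrm{SO}(V)$ be the stabilizer of $F_\bullet$. An \emph{index set} is a subset $P=\{p_1<\dots<p_m\}\subset[1,N]$ of cardinality $m$ such that $i+j\neq N+1$ for all $i,j\in P$. The Schubert variety $X_P\subset\mathrm{OG}$ is the Zariski closure of the $B$-orbit of the point $\langle e_p : p\in P\rangle$. Set $\overline{p}_j=n+2$ if $p_j=n+1$ and $\overline{p}_j=p_j$ otherwise, and \[ Y_P=\{\Sigma\in\mathrm{OG} \mid \dim(\Sigma\cap F_{\overline{p}_j})\ge j \text{ for } 1\le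 j\le m\}. \] Let $[P]=P\cup\{N+1-p\mid p\in P\}$. Set $\mathrm{type}(P)=0$ if $P\cap\{n+1,n+2\}=\emptyset$; otherwise $\mathrm{type}(P)\in\{1,2\}$ is $1$ plus the parity ($0$ or $1$) of the number of integers in $[1,n+1]\smallsetminus P$. Let $\iota(P)$ be the index set obtained from $P$ by interchanging $n+1$ and $n+2$. For index sets $P=\{p_1<\dots<p_m\}$ and $Q=\{q_1<\dots<q_m\}$ write $Q\le P$ if $q_j\le p_j$ for all $j$. The pair $(Q,P)$ is \emph{critical} if there is an integer $c\le n+1$ with $[c,n+1]\subset[P]\cap[Q]$ and $\#(Q\cap[1,c-1])=\#(P\cap[1,c-1])$. Write $Q\preceq P$ if $Q\le P$ and, in case $(Q,P)$ is critical, $\mathrm{type}(Q)=\mathrm{type}(P)$. \textbf{Proposition.} For any index set $P$, the Schubert variety $X_P$ is equal to the set of all $\Sigma\in Y_P$ such that for all integers $c\le n+1$ with $[c,n+1]\subset[P]$ we have $\dim(\Sigma\cap F_{c-1})>\#(P\cap[1,c-1])$ or \[ \dim((\Sigma+F_{c-1})\cap F_{n+1})\equiv c-1+\#(P\cap[c,n+1])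 \pmod 2 . \] If $\mathrm{type}(P)=0$, then $X_P=Y_P$, while if $\mathrm{type}(P)>0$, then $X_P\cup X_{\iota(P)}=Y_P$. For any two index sets $P$ and $Q$, we have $X_Q\subset X_P$ if and only if $Q\preceq P$. -/

import Mathlib

/-! Schubert varieties in the even orthogonal Grassmannian `OG(m, 2n+2)` over `ℂ`. -/

noncomputable section

namespace EvenOG

/-- The interval `[1, N]`, used to number basis vectors. -/
abbrev Idx (N : ℕ) : Type := {i : ℕ // i ∈ Finset.Icc 1 N}

/-- Index sets: subsets `P ⊆ [1, 2n+2]` of cardinality `m` such that no two elements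
(possibly equal) of `P` have sum `N + 1 = 2n+3`. -/
@[ext]
structure IndexSet (n m : ℕ) where
  carrier : Finset ℕ
  subset_Icc : carrier ⊆ Finset.Icc 1 (2 * n + 2)
  card_eq : carrier.card = m
  add_ne : ∀ i ∈ carrier, ∀ j ∈ carrier, i + j ≠ 2 * n + 3

namespace IndexSet

variable {n m : ℕ}

/-- The elements of `P` in increasing order; `P.elt j` is the `(j+1)`-st smallest element,
where `j` runs over `0, …, m-1`. -/
def elt (P : IndexSet n m) (j : Fin m) : ℕ :=
  P.carrier.orderEmbOfFin P.card_eq j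

/-- The elements of `P`, in increasing order, with `n+1` replaced by `n+2`. -/
def barElt (P : IndexSet n m) (j : Fin m) : ℕ :=
  if P.elt j = n + 1 then n + 2 else P.elt j

/-- The type of an index set, an integer in `{0, 1, 2}`. -/
def type (P : IndexSet n m) : ℕ :=
  if P.carrier ∩ {n + 1, n + 2} = ∅ then 0
  else 1 + (Finset.Icc 1 (n + 1) \ P.carrier).card % 2

/-- The symmetrization `[P] = P ∪ {N + 1 - p | p ∈ P}`. -/
def sym (P : IndexSet n m) : Finset ℕ :=
  P.carrier ∪ P.carrier.image (fun p => 2 * n + 3 - p)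

/-- `P.count a b` is the number of elements of `P` in the interval `[a, b]`. -/
def count (P : IndexSet n m) (a b : ℕ) : ℕ :=
  (P.carrier ∩ Finset.Icc a b).card

/-- The involution on index sets that interchanges `n+1` and `n+2`. -/
def iota (P : IndexSet n m) : IndexSet n m where
  carrier := P.carrier.image (Equiv.swap (n + 1) (n + 2))
  subset_Icc := by
    intro x hx
    obtain ⟨p, hp, rfl⟩ := Finset.mem_image.1 hx
    have h := Finset.mem_Icc.1 (P.subset_Icc hp)
    rw [Finset.mem_Icc, Equiv.swap_apply_def]
    split_ifs <;> omega
  card_eq := by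
    rw [Finset.card_image_of_injective _ (Equiv.injective _), P.card_eq]
  add_ne := by
    intro x hx y hy
    obtain ⟨p, hp, rfl⟩ := Finset.mem_image.1 hx
    obtain ⟨q, hq, rfl⟩ := Finset.mem_image.1 hy
    have h := P.add_ne p hp q hq
    rw [Equiv.swap_apply_def, Equiv.swap_apply_def]
    split_ifs <;> omega

/-- The componentwise order `Q ≤ P`. -/
def Le (Q P : IndexSet n m) : Prop :=
  ∀ j : Fin m, Q.elt j ≤ P.elt j

/-- The pair `(Q, P)` is critical: there is a critical index `c ≤ n+1`. -/
def Critical (Q P : IndexSet n m) : Prop :=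
  ∃ c : ℕ, 1 ≤ c ∧ c ≤ n + 1 ∧ Finset.Icc c (n + 1) ⊆ P.sym ∩ Q.sym ∧
    Q.count 1 (c - 1) = P.count 1 (c - 1)

/-- The relation `Q ⪯ P`. -/
def Prec (Q P : IndexSet n m) : Prop :=
  Q.Le P ∧ (Q.Critical P → Q.type = P.type)

end IndexSet

variable {V : Type*} [AddCommGroup V] [Module ℂ V]

/-- A complete isotropic flag `0 = F_0 ⊊ F_1 ⊊ ⋯ ⊊ F_N = V` with `F_i = F_j^⊥` whenever
`i + j = N`. The values `F p` for `p > N` are irrelevant. -/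
structure IsIsotropicFlag (b : LinearMap.BilinForm ℂ V) (N : ℕ) (F : ℕ → Submodule ℂ V) :
    Prop where
  bot : F 0 = ⊥
  top : F N = ⊤
  lt_succ : ∀ i < N, F i < F (i + 1)
  perp : ∀ i j, i + j = N → F i = b.orthogonal (F j)

/-- The basis `e_1, …, e_N` satisfies `(e_i, e_j) = δ_{i+j, N+1}` and
`F_p = ⟨e_1, …, e_p⟩`. -/
structure IsAdapted (b : LinearMap.BilinForm ℂ V) (N : ℕ) (F : ℕ → Submodule ℂ V)
    (e : Module.Basis (Idx N) ℂ V) : Prop where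
  pairing : ∀ i j : Idx N, b (e i) (e j) = if (i : ℕ) + (j : ℕ) = N + 1 then 1 else 0
  flag : ∀ p ≤ N, F p = Submodule.span ℂ (e '' {i | (i : ℕ) ≤ p})

/-- The orthogonal Grassmannian: the `m`-dimensional isotropic subspaces of `V`. -/
def OG (b : LinearMap.BilinForm ℂ V) (m : ℕ) : Set (Submodule ℂ V) :=
  {S | Module.finrank ℂ S = m ∧ ∀ x ∈ S, ∀ y ∈ S, b x y = 0}

/-- The Borel subgroup of `SO(V)` that stabilizes the flag `F`, as a set of automorphisms. -/
def borel (b : LinearMap.BilinForm ℂ V) (N : ℕ) (F : ℕ → Submodule ℂ V) :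
    Set (V ≃ₗ[ℂ] V) :=
  {g | (∀ x y, b (g x) (g y) = b x y) ∧ LinearMap.det (g : V →ₗ[ℂ] V) = 1 ∧
    ∀ p ≤ N, (F p).map (g : V →ₗ[ℂ] V) = F p}

/-- The Plücker coordinates of an `m`-tuple of vectors: the maximal minors of its coordinate
matrix. Columns are listed by an arbitrary sequence `I`; reordering `I` changes the minor by a
sign and a repetition gives `0`, so these are the usual coordinates up to redundancy. -/
def plucker {N m : ℕ} (e : Module.Basis (Idx N) ℂ V) (v : Fin m → V) (I : Fin m → Idx N) : ℂ :=
  Matrix.det (Matrix.of fun r s : Fin m => e.repr (v r) (I s))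

/-- The polynomial `f` in the Plücker coordinates vanishes at the point `S` of the Grassmannian
of `m`-dimensional subspaces. Two bases of `S` have proportional Plücker coordinates, so for
homogeneous `f` it does not matter which basis of `S` is used. -/
def VanishesAt {N m : ℕ} (e : Module.Basis (Idx N) ℂ V)
    (f : MvPolynomial (Fin m → Idx N) ℂ) (S : Submodule ℂ V) : Prop :=
  ∀ v : Fin m → V, LinearIndependent ℂ v → Submodule.span ℂ (Set.range v) = S →
    MvPolynomial.eval (plucker e v) f = 0

/-- The Zariski closure of a subset of `OG(m, N)` as a subvariety of projective space under the
Plücker embedding: all points at which every homogeneous polynomial that vanishes on `A`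
vanishes. -/
def zariskiClosure {N : ℕ} (b : LinearMap.BilinForm ℂ V) (m : ℕ)
    (e : Module.Basis (Idx N) ℂ V) (A : Set (Submodule ℂ V)) : Set (Submodule ℂ V) :=
  {S | S ∈ OG b m ∧ ∀ (d : ℕ) (f : MvPolynomial (Fin m → Idx N) ℂ), f.IsHomogeneous d →
    (∀ T ∈ A, VanishesAt e f T) → VanishesAt e f S}

variable {n m : ℕ}

/-- The coordinate subspace `⟨e_p : p ∈ P⟩`. -/
def coordSubspace (e : Module.Basis (Idx (2 * n + 2)) ℂ V) (P : IndexSet n m) :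
    Submodule ℂ V :=
  Submodule.span ℂ (e '' {i | (i : ℕ) ∈ P.carrier})

/-- The Schubert cell: the orbit of `⟨e_p : p ∈ P⟩` under the Borel subgroup. -/
def schubertCell (b : LinearMap.BilinForm ℂ V) (F : ℕ → Submodule ℂ V)
    (e : Module.Basis (Idx (2 * n + 2)) ℂ V) (P : IndexSet n m) : Set (Submodule ℂ V) :=
  {S | ∃ g ∈ borel b (2 * n + 2) F, S = (coordSubspace e P).map (g : V →ₗ[ℂ] V)}

/-- The Schubert variety `X_P`: the Zariski closure of the Schubert cell. -/
def schubertVariety (b : LinearMap.BilinForm ℂ V) (F : ℕ → Submodule ℂ V)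
    (e : Module.Basis (Idx (2 * n + 2)) ℂ V) (P : IndexSet n m) : Set (Submodule ℂ V) :=
  zariskiClosure b m e (schubertCell b F e P)

/-- The set `Y_P` defined by the dimension inequalities. -/
def schubertY (b : LinearMap.BilinForm ℂ V) (F : ℕ → Submodule ℂ V) (P : IndexSet n m) :
    Set (Submodule ℂ V) :=
  {S | S ∈ OG b m ∧
    ∀ j : Fin m, (j : ℕ) + 1 ≤ Module.finrank ℂ (S ⊓ F (P.barElt j) : Submodule ℂ V)}

/-- The parity conditions on `S`: for all `c` with `[c, n+1] ⊆ [P]`, either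
`dim (S ∩ F_{c-1}) > #(P ∩ [1, c-1])` or
`dim ((S + F_{c-1}) ∩ F_{n+1}) ≡ c - 1 + #(P ∩ [c, n+1])` modulo `2`. -/
def ParityConditions (F : ℕ → Submodule ℂ V) (P : IndexSet n m) (S : Submodule ℂ V) : Prop :=
  ∀ c : ℕ, 1 ≤ c → c ≤ n + 1 → Finset.Icc c (n + 1) ⊆ P.sym →
    P.count 1 (c - 1) < Module.finrank ℂ (S ⊓ F (c - 1) : Submodule ℂ V) ∨
    Module.finrank ℂ ((S ⊔ F (c - 1)) ⊓ F (n + 1) : Submodule ℂ V) ≡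
      c - 1 + P.count c (n + 1) [MOD 2]

end EvenOG

end

/-! By the Bruhat decomposition (`exists_mem_schubertCell`) every point of `OG` lies in the cell of
some index set `Q`. On that cell the dimensions occurring in `Y_P` and in the parity conditions are
constant and count elements of `Q` (`finrank_inf_flag`, `finrank_sup_inf_flag`). Everything
therefore reduces to combinatorics (`prec_iff_parity`, `prec_or_prec_iota`), once a point of the
cell of `Q` is known to lie in `X_P` exactly when `Q ⪯ P` (`mem_schubertVariety_iff`).

If `Q ⪯ P`, a chain of elementary moves leads from `P` down to `Q` (`reachable_of_prec`). Each move
is realized by a one-parameter family of isometries that exhibits every point of the lower cell as a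
limit of points of the upper one (`schubertCell_subset_of_move`). A step that respects `≤` may
violate the type condition; the chain is then rerouted through `ι` or through an index set of type
`0`, for which types impose nothing. The detour through type `0` uses `m < n + 1`.

Conversely, the Plücker coordinate of `Q` vanishes nowhere on the cell of `Q`. If it is nonzero at a
point of the cell of `P`, that point is transverse to the coordinate subspace opposite to `Q`.
Counting dimensions inside each `F_k` gives `Q ≤ P`. In the critical case the transversality passes
to maximal isotropic subspaces, and then the determinant of the isometry is a sign that compares the
types; since `B ⊂ SO(V)`, the types agree (`type_eq_of_opposite`). So this coordinate vanishes on
all of `X_P` unless `Q ⪯ P`. -/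

namespace EvenOG

/-! ### Counting functions of finite sets. -/

/-- The number of elements of `S` in `[1, k]`. -/
def cnt (S : Finset ℕ) (k : ℕ) : ℕ := (S ∩ Finset.Icc 1 k).card

lemma cnt_zero (S : Finset ℕ) : cnt S 0 = 0 := by simp [cnt]

lemma cnt_succ (S : Finset ℕ) (k : ℕ) :
    cnt S (k + 1) = cnt S k + if k + 1 ∈ S then 1 else 0 := by
  have h : Finset.Icc 1 (k + 1) = insert (k + 1) (Finset.Icc 1 k) := by
    ext x; simp; omega
  unfold cnt
  rw [h]
  split_ifs with hk
  · rw [Finset.inter_insert_of_mem hk, Finset.card_insert_of_notMem (by simp)]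
  · rw [Finset.inter_insert_of_notMem hk, add_zero]

lemma cnt_mono (S : Finset ℕ) {k l : ℕ} (h : k ≤ l) : cnt S k ≤ cnt S l :=
  Finset.card_le_card (Finset.inter_subset_inter_left (Finset.Icc_subset_Icc_right h))

lemma cnt_insert {S : Finset ℕ} {x : ℕ} (hx : x ∉ S) (h1 : 1 ≤ x) (k : ℕ) :
    cnt (insert x S) k = cnt S k + if x ≤ k then 1 else 0 := by
  unfold cnt
  split_ifs with hk
  · rw [Finset.insert_inter_of_mem (by simp; omega), Finset.card_insert_of_notMem (by simp [hx])]
  · rw [Finset.insert_inter_of_notMem (by simp; omega), add_zero]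

lemma cnt_erase {S : Finset ℕ} {x : ℕ} (hx : x ∈ S) (h1 : 1 ≤ x) (k : ℕ) :
    cnt (S.erase x) k + (if x ≤ k then 1 else 0) = cnt S k := by
  conv_rhs => rw [← Finset.insert_erase hx]
  rw [cnt_insert (Finset.notMem_erase x S) h1]

lemma cnt_pred (S : Finset ℕ) {k : ℕ} (hk : 1 ≤ k) :
    cnt S k = cnt S (k - 1) + if k ∈ S then 1 else 0 := by
  obtain ⟨k, rfl⟩ := Nat.exists_eq_add_of_le' hk
  exact cnt_succ S k

lemma cnt_eq_of_disjoint {S : Finset ℕ} {a b : ℕ} (hab : a ≤ b)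
    (h : ∀ x, a < x → x ≤ b → x ∉ S) : cnt S b = cnt S a := by
  induction b, hab using Nat.le_induction with
  | base => rfl
  | succ b hab ih =>
    rw [cnt_succ, if_neg (h _ (by omega) le_rfl), add_zero]
    exact ih fun x h1 h2 => h x h1 (by omega)

lemma cnt_eq_of_subset {S : Finset ℕ} {a b : ℕ} (hab : a ≤ b)
    (h : ∀ x, a < x → x ≤ b → x ∈ S) : cnt S b = cnt S a + (b - a) := by
  induction b, hab using Nat.le_induction with
  | base => simp
  | succ b hab ih =>
    rw [cnt_succ, if_pos (h _ (by omega) le_rfl), ih fun x h1 h2 => h x h1 (by omega)]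
    omega

lemma cnt_le_add (S : Finset ℕ) {a b : ℕ} (hab : a ≤ b) : cnt S b ≤ cnt S a + (b - a) := by
  induction b, hab using Nat.le_induction with
  | base => simp
  | succ b hab ih =>
    rw [cnt_succ]
    split_ifs <;> omega

/-! ### Index sets: order, types, critical pairs and the involution `ι`. -/

namespace IndexSet

variable {n m : ℕ}

lemma count_one (P : IndexSet n m) (k : ℕ) : P.count 1 k = cnt P.carrier k := rfl

lemma cnt_le (P : IndexSet n m) (k : ℕ) : cnt P.carrier k ≤ m := by
  exact (Finset.card_le_card Finset.inter_subset_left).trans_eq P.card_eq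

lemma mem_bounds (P : IndexSet n m) {x : ℕ} (hx : x ∈ P.carrier) : 1 ≤ x ∧ x ≤ 2 * n + 2 :=
  Finset.mem_Icc.1 (P.subset_Icc hx)

lemma cnt_top (P : IndexSet n m) {k : ℕ} (hk : 2 * n + 2 ≤ k) : cnt P.carrier k = m := by
  unfold cnt
  rw [Finset.inter_eq_left.2, P.card_eq]
  exact P.subset_Icc.trans (Finset.Icc_subset_Icc_right hk)

lemma dual_notMem (P : IndexSet n m) {x : ℕ} (hx : x ∈ P.carrier) : 2 * n + 3 - x ∉ P.carrier := by
  intro h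
  have := P.mem_bounds hx
  exact P.add_ne _ hx _ h (by omega)

lemma count_add (P : IndexSet n m) {c d : ℕ} (h1 : 1 ≤ c) (hcd : c ≤ d + 1) :
    cnt P.carrier (c - 1) + P.count c d = cnt P.carrier d := by
  unfold cnt count
  rw [← Finset.card_union_of_disjoint]
  · rw [← Finset.inter_union_distrib_left]
    congr 2
    ext x
    simp
    omega
  · refine Finset.disjoint_left.2 fun x hx hy => ?_
    simp at hx hy
    omega

lemma elt_le_iff (P : IndexSet n m) (j : Fin m) (k : ℕ) :
    P.elt j ≤ k ↔ (j : ℕ) < cnt P.carrier k := by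
  have hmem : ∀ i, P.elt i ∈ P.carrier := fun i => Finset.orderEmbOfFin_mem _ _ _
  have hinj : Function.Injective P.elt := (P.carrier.orderEmbOfFin P.card_eq).injective
  have hmono : ∀ i i', P.elt i ≤ P.elt i' ↔ i ≤ i' := fun i i' =>
    (P.carrier.orderEmbOfFin P.card_eq).le_iff_le
  constructor
  · intro h
    have hsub : (Finset.Iic j).image P.elt ⊆ P.carrier ∩ Finset.Icc 1 k := by
      intro x hx
      obtain ⟨i, hi, rfl⟩ := Finset.mem_image.1 hx
      have := (hmono i j).2 (Finset.mem_Iic.1 hi)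
      simp [hmem i, (P.mem_bounds (hmem i)).1]
      omega
    have := Finset.card_le_card hsub
    rw [Finset.card_image_of_injective _ hinj, Fin.card_Iic] at this
    exact this
  · intro h
    by_contra hk
    have hsub : P.carrier ∩ Finset.Icc 1 k ⊆ (Finset.Iio j).image P.elt := by
      intro x hx
      simp only [Finset.mem_inter, Finset.mem_Icc] at hx
      have hx' : x ∈ Set.range (P.carrier.orderEmbOfFin P.card_eq) := by
        rw [Finset.range_orderEmbOfFin]; exact hx.1
      obtain ⟨i, rfl⟩ := hx'
      refine Finset.mem_image.2 ⟨i, Finset.mem_Iio.2 ?_, rfl⟩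
      by_contra hij
      have := (hmono j i).2 (not_lt.1 hij)
      have h2 := hx.2.2
      change P.elt i ≤ k at h2
      omega
    have := Finset.card_le_card hsub
    rw [Finset.card_image_of_injective _ hinj, Fin.card_Iio] at this
    unfold cnt at h
    omega

/-- Larger elements mean smaller counts. All later order arguments use counting functions, since a
replacement changes them by indicator functions of half-lines. -/
lemma le_iff_cnt (Q P : IndexSet n m) :
    Q.Le P ↔ ∀ k, cnt P.carrier k ≤ cnt Q.carrier k := by
  constructor
  · intro h k
    by_contra! hk
    have hj : cnt Q.carrier k < m := hk.trans_le (P.cnt_le k)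
    have h1 := (P.elt_le_iff ⟨_, hj⟩ k).2 hk
    have h2 := (Q.elt_le_iff ⟨_, hj⟩ k).1 ((h _).trans h1)
    exact lt_irrefl _ h2
  · intro h j
    rw [elt_le_iff]
    exact ((P.elt_le_iff j _).1 le_rfl).trans_le (h _)

/-- The inequalities that define `Y_P`, for a coordinate subspace, in terms of counting functions. -/
lemma barElt_iff_cnt (Q P : IndexSet n m) :
    (∀ j : Fin m, (j : ℕ) + 1 ≤ cnt Q.carrier (P.barElt j)) ↔
      ∀ k, k ≠ n + 1 → cnt P.carrier k ≤ cnt Q.carrier k := by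
  constructor
  · intro h k hk1
    by_contra! hk
    have hj : cnt Q.carrier k < m := hk.trans_le (P.cnt_le k)
    have h1 := (P.elt_le_iff ⟨_, hj⟩ k).2 hk
    have h2 := h ⟨_, hj⟩
    -- This is where `k ≠ n + 1` enters: the bar raises only the value `n + 1`, to `n + 2`.
    have h3 : P.barElt ⟨_, hj⟩ ≤ k := by
      unfold barElt
      split_ifs <;> omega
    have := cnt_mono Q.carrier h3
    simp only at h2
    omega
  · intro h j
    have h1 := (P.elt_le_iff j _).1 le_rfl
    unfold barElt
    split_ifs with hj
    · have h2 := h (n + 2) (by omega)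
      rw [hj] at h1
      have := cnt_mono P.carrier (show n + 1 ≤ n + 2 by omega)
      omega
    · have := h _ hj
      omega

lemma Icc_subset_sym_iff (P : IndexSet n m) (c : ℕ) (hc : 1 ≤ c) :
    Finset.Icc c (n + 1) ⊆ P.sym ↔
      ∀ x, c ≤ x → x ≤ n + 1 → x ∈ P.carrier ∨ 2 * n + 3 - x ∈ P.carrier := by
  have key : ∀ x, 1 ≤ x → x ≤ n + 1 →
      (x ∈ P.sym ↔ x ∈ P.carrier ∨ 2 * n + 3 - x ∈ P.carrier) := by
    intro x h1 h2
    simp only [sym, Finset.mem_union, Finset.mem_image]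
    refine or_congr_right ⟨?_, fun h => ⟨_, h, by omega⟩⟩
    rintro ⟨y, hy, rfl⟩
    have := P.mem_bounds hy
    convert hy using 1
    omega
  constructor
  · intro h x h1 h2
    exact (key x (hc.trans h1) h2).1 (h (Finset.mem_Icc.2 ⟨h1, h2⟩))
  · intro h x hx
    obtain ⟨h1, h2⟩ := Finset.mem_Icc.1 hx
    exact (key x (hc.trans h1) h2).2 (h x h1 h2)

lemma type_eq_zero_iff (P : IndexSet n m) :
    P.type = 0 ↔ n + 1 ∉ P.carrier ∧ n + 2 ∉ P.carrier := by
  have : P.carrier ∩ {n + 1, n + 2} = ∅ ↔ n + 1 ∉ P.carrier ∧ n + 2 ∉ P.carrier := by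
    rw [← Finset.disjoint_iff_inter_eq_empty]
    simp
  unfold type
  rw [← this]
  split_ifs with h <;> simp [h]

lemma type_of_ne_zero (P : IndexSet n m) (h : P.type ≠ 0) :
    P.type = 1 + (n + 1 - cnt P.carrier (n + 1)) % 2 := by
  unfold type at h ⊢
  rw [if_neg (by intro h'; simp [h'] at h), Finset.card_sdiff]
  simp [cnt]

/-- A positive type is a parity of `n + 1 - cnt`, and this subtraction does not truncate because at
most `n + 1` elements lie in `[1, n + 1]`. -/
lemma type_eq_iff (P Q : IndexSet n m) (hP : P.type ≠ 0) (hQ : Q.type ≠ 0) :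
    Q.type = P.type ↔ cnt Q.carrier (n + 1) ≡ cnt P.carrier (n + 1) [MOD 2] := by
  rw [type_of_ne_zero P hP, type_of_ne_zero Q hQ]
  have h1 := cnt_le_add P.carrier (Nat.zero_le (n + 1))
  have h2 := cnt_le_add Q.carrier (Nat.zero_le (n + 1))
  rw [cnt_zero] at h1 h2
  unfold Nat.ModEq
  omega

/-- The number of elements of `P` in `[n + 2 - j, n + 1 + j]` is at most `j`, with equality
exactly if `[P]` contains this interval. -/
lemma cnt_middle (P : IndexSet n m) (j : ℕ) (hj : j ≤ n + 1) :
    cnt P.carrier (n + 1 + j) ≤ cnt P.carrier (n + 1 - j) + j ∧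
    (cnt P.carrier (n + 1 + j) = cnt P.carrier (n + 1 - j) + j ↔
      ∀ x, n + 2 - j ≤ x → x ≤ n + 1 → x ∈ P.carrier ∨ 2 * n + 3 - x ∈ P.carrier) := by
  induction j with
  | zero =>
    exact ⟨by simp, fun _ x h1 h2 => by omega, fun _ => by simp⟩
  | succ j ih =>
    obtain ⟨ih1, ih2⟩ := ih (by omega)
    have e1 := cnt_succ P.carrier (n + 1 + j)
    have e2 := cnt_pred P.carrier (show 1 ≤ n + 1 - j by omega)
    rw [show n + 1 - j - 1 = n + 1 - (j + 1) by omega] at e2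
    -- The two endpoints added to the interval are dual to each other, so at most one of them is in
    -- `P`.
    have e3 : n + 1 - j ∈ P.carrier → n + 1 + j + 1 ∉ P.carrier := by
      intro h
      have := P.dual_notMem h
      rwa [show 2 * n + 3 - (n + 1 - j) = n + 1 + j + 1 by omega] at this
    have split : (∀ x, n + 2 - (j + 1) ≤ x → x ≤ n + 1 →
        x ∈ P.carrier ∨ 2 * n + 3 - x ∈ P.carrier) ↔
        (n + 1 - j ∈ P.carrier ∨ n + 1 + j + 1 ∈ P.carrier) ∧
        (∀ x, n + 2 - j ≤ x → x ≤ n + 1 → x ∈ P.carrier ∨ 2 * n + 3 - x ∈ P.carrier) := by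
      constructor
      · intro h
        refine ⟨?_, fun x h1 h2 => h x (by omega) h2⟩
        have := h (n + 1 - j) (by omega) (by omega)
        rwa [show 2 * n + 3 - (n + 1 - j) = n + 1 + j + 1 by omega] at this
      · rintro ⟨h1, h2⟩ x hx1 hx2
        by_cases hx : x = n + 1 - j
        · subst hx
          rwa [show 2 * n + 3 - (n + 1 - j) = n + 1 + j + 1 by omega]
        · exact h2 x (by omega) hx2
    rw [split, ← ih2, ← add_assoc]
    by_cases a1 : n + 1 - j ∈ P.carrier <;> by_cases a2 : n + 1 + j + 1 ∈ P.carrier <;>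
      simp only [a1, a2, if_true, if_false] at e1 e2 ⊢ <;>
      first
        | exact absurd a2 (e3 a1)
        | (simp only [true_or, or_true, or_self, false_and, true_and, iff_false]; omega)

lemma critical_iff (Q P : IndexSet n m) :
    Q.Critical P ↔ ∃ c, 1 ≤ c ∧ c ≤ n + 1 ∧
      (∀ x, c ≤ x → x ≤ n + 1 → x ∈ P.carrier ∨ 2 * n + 3 - x ∈ P.carrier) ∧
      (∀ x, c ≤ x → x ≤ n + 1 → x ∈ Q.carrier ∨ 2 * n + 3 - x ∈ Q.carrier) ∧
      cnt Q.carrier (c - 1) = cnt P.carrier (c - 1) := by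
  unfold Critical
  refine exists_congr fun c => and_congr_right fun hc => and_congr_right fun _ => ?_
  rw [Finset.subset_inter_iff, Icc_subset_sym_iff P c hc, Icc_subset_sym_iff Q c hc, and_assoc]
  rfl

lemma Critical.type_ne_zero {Q P : IndexSet n m} (h : Q.Critical P) :
    Q.type ≠ 0 ∧ P.type ≠ 0 := by
  obtain ⟨c, _, h2, h3, h4, _⟩ := (critical_iff Q P).1 h
  have h3' := h3 (n + 1) h2 le_rfl
  have h4' := h4 (n + 1) h2 le_rfl
  rw [show 2 * n + 3 - (n + 1) = n + 2 by omega] at h3' h4'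
  rw [Ne, Ne, type_eq_zero_iff, type_eq_zero_iff]
  tauto

/-- The combinatorial form of the description of `X_P` by parity conditions. -/
lemma prec_iff_parity (Q P : IndexSet n m) :
    Q.Prec P ↔ (∀ k, k ≠ n + 1 → cnt P.carrier k ≤ cnt Q.carrier k) ∧
      ∀ c : ℕ, 1 ≤ c → c ≤ n + 1 → Finset.Icc c (n + 1) ⊆ P.sym →
        P.count 1 (c - 1) < cnt Q.carrier (c - 1) ∨
        c - 1 + Q.count c (n + 1) ≡ c - 1 + P.count c (n + 1) [MOD 2] := by
  unfold Prec
  rw [le_iff_cnt]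
  constructor
  · rintro ⟨h1, h2⟩
    refine ⟨fun k _ => h1 k, fun c hc1 hc2 hc3 => ?_⟩
    rw [count_one, or_iff_not_imp_left]
    intro h3
    have h4 := h1 (c - 1)
    have hP := (Icc_subset_sym_iff P c hc1).1 hc3
    have hmP := (P.cnt_middle (n + 2 - c) (by omega)).2
    have hmQ := Q.cnt_middle (n + 2 - c) (by omega)
    rw [show n + 2 - (n + 2 - c) = c by omega, show n + 1 - (n + 2 - c) = c - 1 by omega]
      at hmP hmQ
    have h5 := h1 (n + 1 + (n + 2 - c))
    have h6 := hmP.2 hP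
    -- `P` has as many elements in `[c, N + 1 - c]` as an index set can have. As `Q` agrees with `P`
    -- in count at `c - 1` and is at least as large at `N + 1 - c`, it is maximal there too, so `c`
    -- is a critical index.
    have hQ := hmQ.2.1 (by omega)
    have hcrit : Q.Critical P := (critical_iff Q P).2 ⟨c, hc1, hc2, hP, hQ, by omega⟩
    have h7 := (type_eq_iff P Q hcrit.type_ne_zero.2 hcrit.type_ne_zero.1).1 (h2 hcrit)
    have h8 := P.count_add hc1 (show c ≤ n + 1 + 1 by omega)
    have h9 := Q.count_add hc1 (show c ≤ n + 1 + 1 by omega)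
    unfold Nat.ModEq at h7 ⊢
    omega
  · rintro ⟨h1, h2⟩
    constructor
    · intro k
      by_cases hk : k = n + 1
      · subst hk
        have h3 := h1 n (by omega)
        rw [cnt_succ, cnt_succ]
        -- The missing inequality at `n + 1` follows from the one at `n` unless `n + 1 ∈ P`; then
        -- the parity condition for `c = n + 1` supplies it.
        by_cases hP : n + 1 ∈ P.carrier
        · have h4 := h2 (n + 1) (by omega) le_rfl ((Icc_subset_sym_iff P _ (by omega)).2 (by
            intro x hx1 hx2
            obtain rfl : x = n + 1 := by omega
            exact Or.inl hP))
          have h8 := P.count_add (show 1 ≤ n + 1 by omega) (show n + 1 ≤ n + 1 + 1 by omega)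
          have h9 := Q.count_add (show 1 ≤ n + 1 by omega) (show n + 1 ≤ n + 1 + 1 by omega)
          rw [cnt_succ] at h8 h9
          rw [count_one] at h4
          simp only [hP, if_true, add_tsub_cancel_right] at h4 h8 h9 ⊢
          unfold Nat.ModEq at h4
          split_ifs at h9 ⊢ <;> omega
        · simp only [hP, if_false]
          omega
      · exact h1 k hk
    · intro hcrit
      rw [type_eq_iff P Q hcrit.type_ne_zero.2 hcrit.type_ne_zero.1]
      obtain ⟨c, hc1, hc2, hP, hQ, h3⟩ := (critical_iff Q P).1 hcrit
      have h4 := h2 c hc1 hc2 ((Icc_subset_sym_iff P _ hc1).2 hP)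
      have h8 := P.count_add hc1 (show c ≤ n + 1 + 1 by omega)
      have h9 := Q.count_add hc1 (show c ≤ n + 1 + 1 by omega)
      rw [count_one] at h4
      unfold Nat.ModEq at h4 ⊢
      omega

lemma mem_iota (P : IndexSet n m) (x : ℕ) :
    x ∈ P.iota.carrier ↔ Equiv.swap (n + 1) (n + 2) x ∈ P.carrier := by
  simp only [iota, Finset.mem_image]
  constructor
  · rintro ⟨y, hy, rfl⟩
    rwa [Equiv.swap_apply_self]
  · intro h
    exact ⟨_, h, Equiv.swap_apply_self _ _ _⟩

lemma mem_iota_of_ne (P : IndexSet n m) {x : ℕ} (h1 : x ≠ n + 1) (h2 : x ≠ n + 2) :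
    x ∈ P.iota.carrier ↔ x ∈ P.carrier := by
  rw [mem_iota, Equiv.swap_apply_of_ne_of_ne h1 h2]

lemma mem_iota_left (P : IndexSet n m) : n + 1 ∈ P.iota.carrier ↔ n + 2 ∈ P.carrier := by
  rw [mem_iota, Equiv.swap_apply_left]

lemma mem_iota_right (P : IndexSet n m) : n + 2 ∈ P.iota.carrier ↔ n + 1 ∈ P.carrier := by
  rw [mem_iota, Equiv.swap_apply_right]

lemma cnt_iota (P : IndexSet n m) {k : ℕ} (hk : k ≠ n + 1) :
    cnt P.iota.carrier k = cnt P.carrier k := by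
  induction k using Nat.strong_induction_on with
  | _ k ih =>
    rcases k with _ | k
    · simp [cnt_zero]
    by_cases h2 : k = n + 1
    · subst h2
      rw [cnt_succ, cnt_succ, cnt_succ, cnt_succ, ih n (by omega) (by omega)]
      simp only [mem_iota_left, mem_iota_right, show n + 1 + 1 = n + 2 from rfl]
      omega
    · rw [cnt_succ, cnt_succ, ih k (by omega) h2]
      simp only [P.mem_iota_of_ne hk (show k + 1 ≠ n + 2 by omega)]

/-- Exactly one of `P` and `ι(P)` contains `n + 1`, so the two counts are consecutive integers. In
particular the two types are opposite. -/
lemma cnt_iota_middle (P : IndexSet n m) (hP : P.type ≠ 0) :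
    cnt P.iota.carrier (n + 1) + cnt P.carrier (n + 1) = 2 * cnt P.carrier n + 1 := by
  rw [cnt_succ, cnt_succ, cnt_iota P (by omega)]
  simp only [mem_iota_left]
  rw [Ne, type_eq_zero_iff] at hP
  have h : n + 1 ∈ P.carrier → n + 2 ∉ P.carrier := by
    intro h
    have := P.dual_notMem h
    rwa [show 2 * n + 3 - (n + 1) = n + 2 by omega] at this
  by_cases a1 : n + 1 ∈ P.carrier <;> by_cases a2 : n + 2 ∈ P.carrier <;>
    simp [a1, a2] at h hP ⊢ <;> omega

lemma type_iota_ne_zero (P : IndexSet n m) (hP : P.type ≠ 0) : P.iota.type ≠ 0 := by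
  rw [Ne, type_eq_zero_iff] at hP ⊢
  rw [mem_iota_left, mem_iota_right]
  tauto

lemma iota_eq_self (P : IndexSet n m) (hP : P.type = 0) : P.iota = P := by
  rw [type_eq_zero_iff] at hP
  ext x
  by_cases h1 : x = n + 1
  · subst h1; rw [mem_iota_left]; tauto
  by_cases h2 : x = n + 2
  · subst h2; rw [mem_iota_right]; tauto
  exact P.mem_iota_of_ne h1 h2

lemma prec_of_type_zero {Q P : IndexSet n m} (hle : Q.Le P) (h : Q.type = 0 ∨ P.type = 0) :
    Q.Prec P :=
  ⟨hle, fun hc => by have := hc.type_ne_zero; tauto⟩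

/-- If all inequalities but the one at `n + 1` hold, then `Q ⪯ P` or `Q ⪯ ι(P)`. -/
lemma prec_or_prec_iota (Q P : IndexSet n m)
    (h : ∀ k, k ≠ n + 1 → cnt P.carrier k ≤ cnt Q.carrier k) (hP : P.type ≠ 0) :
    Q.Prec P ∨ Q.Prec P.iota := by
  have hn := h n (by omega)
  have hn2 := h (n + 2) (by omega)
  have hpi := P.cnt_iota_middle hP
  have hpm := cnt_mono P.carrier (show n ≤ n + 1 by omega)
  have him := cnt_mono P.iota.carrier (show n ≤ n + 1 by omega)
  have hqm := cnt_mono Q.carrier (show n ≤ n + 1 by omega)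
  have hi := P.cnt_iota (show n ≠ n + 1 by omega)
  have hs := cnt_succ P.carrier n
  have hs' := cnt_succ P.iota.carrier n
  by_cases hQ : Q.type = 0
  · -- one of the two sets contains `n + 2`
    by_cases hmem : n + 1 ∈ P.carrier
    · right
      refine prec_of_type_zero ((le_iff_cnt _ _).2 fun k => ?_) (Or.inl hQ)
      by_cases hk : k = n + 1
      · subst hk
        simp only [hmem, if_true] at hs
        omega
      · rw [cnt_iota _ hk]; exact h k hk
    · left
      refine prec_of_type_zero ((le_iff_cnt _ _).2 fun k => ?_) (Or.inl hQ)
      by_cases hk : k = n + 1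
      · subst hk
        simp only [hmem, if_false] at hs
        omega
      · exact h k hk
  -- `Q` has the type of exactly one of `P` and `ι(P)`. If `P` fails on type alone, the parity gap
  -- forces a strict inequality at `n + 1`, enough for `ι(P)`. If `P` fails at `n + 1`, then `n + 1`
  -- lies in `P`, and `ι(P)` and `Q` have equal counts there.
  by_cases hc : cnt P.carrier (n + 1) ≤ cnt Q.carrier (n + 1)
  · by_cases hp : Q.Prec P
    · exact Or.inl hp
    right
    have hle : Q.Le P := (le_iff_cnt _ _).2 fun k => by
      by_cases hk : k = n + 1
      · subst hk; exact hc
      · exact h k hk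
    have hne : Q.type ≠ P.type := fun he => hp ⟨hle, fun _ => he⟩
    rw [Ne, type_eq_iff P Q hP hQ] at hne
    unfold Nat.ModEq at hne
    refine ⟨(le_iff_cnt _ _).2 fun k => ?_, fun _ => ?_⟩
    · by_cases hk : k = n + 1
      · subst hk
        omega
      · rw [cnt_iota _ hk]; exact h k hk
    · rw [type_eq_iff _ Q (P.type_iota_ne_zero hP) hQ]
      unfold Nat.ModEq
      omega
  · right
    refine ⟨(le_iff_cnt _ _).2 fun k => ?_, fun _ => ?_⟩
    · by_cases hk : k = n + 1
      · subst hk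
        omega
      · rw [cnt_iota _ hk]; exact h k hk
    · rw [type_eq_iff _ Q (P.type_iota_ne_zero hP) hQ]
      unfold Nat.ModEq
      split_ifs at hs <;> omega

end IndexSet

end EvenOG

/-! ### Elementary moves and chains of moves from `P` down to `Q`. -/

namespace EvenOG

lemma cnt_congr {S T : Finset ℕ} {k : ℕ} (h : ∀ x ≤ k, x ∈ S ↔ x ∈ T) : cnt S k = cnt T k := by
  unfold cnt
  congr 1
  ext x
  simp only [Finset.mem_inter, Finset.mem_Icc]
  constructor <;> rintro ⟨h1, h2, h3⟩
  · exact ⟨(h x h3).1 h1, h2, h3⟩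
  · exact ⟨(h x h3).2 h1, h2, h3⟩

namespace IndexSet

variable {n m : ℕ}

/-- An elementary move from `P` down to `R`: the element `p` is lowered to `q` and, if `N + 1 - q`
belongs to `P`, it is lowered to `N + 1 - p` at the same time. -/
def Move (P R : IndexSet n m) : Prop :=
  ∃ p q : ℕ, 1 ≤ q ∧ q < p ∧ p + q ≠ 2 * n + 3 ∧ p ∈ P.carrier ∧
    ∀ i ∈ R.carrier, i = q ∨ (i = 2 * n + 3 - p ∧ 2 * n + 3 - q ∈ P.carrier) ∨
      (i ∈ P.carrier ∧ i ≠ p ∧ i ≠ q ∧ i ≠ 2 * n + 3 - p ∧ i ≠ 2 * n + 3 - q)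

/-- Replace the element `p` of `P` by `q`. -/
def replace (P : IndexSet n m) (p q : ℕ) (hp : p ∈ P.carrier) (hq1 : 1 ≤ q)
    (hq2 : q ≤ 2 * n + 2) (hq : q ∉ P.carrier) (hq' : 2 * n + 3 - q ∉ P.carrier) :
    IndexSet n m where
  carrier := insert q (P.carrier.erase p)
  subset_Icc := by
    intro x hx
    rcases Finset.mem_insert.1 hx with rfl | hx
    · exact Finset.mem_Icc.2 ⟨hq1, hq2⟩
    · exact P.subset_Icc (Finset.mem_of_mem_erase hx)
  card_eq := by
    rw [Finset.card_insert_of_notMem (fun h => hq (Finset.mem_of_mem_erase h)),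
      Finset.card_erase_of_mem hp, P.card_eq]
    have := Finset.card_pos.2 ⟨p, hp⟩
    rw [P.card_eq] at this
    omega
  add_ne := by
    intro x hx y hy hxy
    rcases Finset.mem_insert.1 hx with hx1 | hx1 <;> rcases Finset.mem_insert.1 hy with hy1 | hy1
    · omega
    · exact hq' (by convert Finset.mem_of_mem_erase hy1 using 1; omega)
    · exact hq' (by convert Finset.mem_of_mem_erase hx1 using 1; omega)
    · exact P.add_ne x (Finset.mem_of_mem_erase hx1) y (Finset.mem_of_mem_erase hy1) hxy

lemma add_ne_of_dual_notMem (P : IndexSet n m) {p q : ℕ} (hp : p ∈ P.carrier)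
    (hq' : 2 * n + 3 - q ∉ P.carrier) : p + q ≠ 2 * n + 3 := by
  intro h
  exact hq' (by convert hp using 1; omega)

section replace

variable (P : IndexSet n m) {p q : ℕ} (hp : p ∈ P.carrier) (hq1 : 1 ≤ q)
    (hq2 : q ≤ 2 * n + 2) (hq : q ∉ P.carrier) (hq' : 2 * n + 3 - q ∉ P.carrier)

lemma mem_replace (x : ℕ) :
    x ∈ (P.replace p q hp hq1 hq2 hq hq').carrier ↔ x = q ∨ (x ≠ p ∧ x ∈ P.carrier) := by
  simp [replace]

lemma cnt_replace (k : ℕ) :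
    cnt (P.replace p q hp hq1 hq2 hq hq').carrier k + (if p ≤ k then 1 else 0) =
      cnt P.carrier k + if q ≤ k then 1 else 0 := by
  change cnt (insert q (P.carrier.erase p)) k + _ = _
  rw [cnt_insert (fun h => hq (Finset.mem_of_mem_erase h)) hq1,
    ← cnt_erase hp (P.mem_bounds hp).1 k]
  omega

lemma move_replace (h : q < p) : Move P (P.replace p q hp hq1 hq2 hq hq') := by
  refine ⟨p, q, hq1, h, P.add_ne_of_dual_notMem hp hq', hp, fun i hi => ?_⟩
  rcases (P.mem_replace hp hq1 hq2 hq hq' i).1 hi with rfl | ⟨h1, h2⟩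
  · exact Or.inl rfl
  · refine Or.inr (Or.inr ⟨h2, h1, ?_, ?_, ?_⟩)
    · rintro rfl; exact hq h2
    · rintro rfl; exact P.dual_notMem hp h2
    · rintro rfl; exact hq' h2

lemma move_of_replace (h : p < q) : Move (P.replace p q hp hq1 hq2 hq hq') P := by
  have hb := P.mem_bounds hp
  have hpq := P.add_ne_of_dual_notMem hp hq'
  refine ⟨q, p, hb.1, h, by omega, (P.mem_replace hp hq1 hq2 hq hq' q).2 (Or.inl rfl),
    fun i hi => ?_⟩
  by_cases hip : i = p
  · exact Or.inl hip
  · refine Or.inr (Or.inr ⟨(P.mem_replace hp hq1 hq2 hq hq' i).2 (Or.inr ⟨hip, hi⟩), ?_, hip,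
      ?_, ?_⟩)
    · rintro rfl; exact hq hi
    · rintro rfl; exact hq' hi
    · rintro rfl; exact P.dual_notMem hp hi

end replace

/-- Replace two elements of `P` by their duals. -/
def dualize (P : IndexSet n m) (p s : ℕ) (hp : p ∈ P.carrier) (hs : s ∈ P.carrier)
    (hps : p ≠ s) : IndexSet n m :=
  have hbp := P.mem_bounds hp
  have hbs := P.mem_bounds hs
  have hp' := P.dual_notMem hp
  have hs' := P.dual_notMem hs
  have hpp : 2 * n + 3 - (2 * n + 3 - p) = p := by omega
  have hss : 2 * n + 3 - (2 * n + 3 - s) = s := by omega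
  { carrier := insert (2 * n + 3 - p) (insert (2 * n + 3 - s) ((P.carrier.erase p).erase s))
    subset_Icc := by
      intro x hx
      simp only [Finset.mem_insert, Finset.mem_erase] at hx
      rcases hx with rfl | rfl | ⟨_, _, hx⟩
      · rw [Finset.mem_Icc]; omega
      · rw [Finset.mem_Icc]; omega
      · exact P.subset_Icc hx
    card_eq := by
      have h1 : s ∈ P.carrier.erase p := Finset.mem_erase.2 ⟨hps.symm, hs⟩
      have h2 := Finset.card_pos.2 ⟨s, h1⟩
      rw [Finset.card_insert_of_notMem, Finset.card_insert_of_notMem,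
        Finset.card_erase_of_mem h1]
      · rw [Finset.card_erase_of_mem hp, P.card_eq] at h2 ⊢
        omega
      · simp only [Finset.mem_erase]; tauto
      · simp only [Finset.mem_insert, Finset.mem_erase]
        have : 2 * n + 3 - p ≠ 2 * n + 3 - s := by omega
        tauto
    add_ne := by
      intro x hx y hy hxy
      simp only [Finset.mem_insert, Finset.mem_erase] at hx hy
      have hyx : y = 2 * n + 3 - x := by omega
      subst hyx
      rcases hx with rfl | rfl | ⟨hx1, hx2, hx⟩
      · rw [hpp] at hy
        rcases hy with hy | hy | hy
        · omega
        · rw [← hy] at hs'; exact hs' hp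
        · tauto
      · rw [hss] at hy
        rcases hy with hy | hy | hy
        · rw [← hy] at hp'; exact hp' hs
        · omega
        · tauto
      · have := P.mem_bounds hx
        rcases hy with hy | hy | hy
        · omega
        · omega
        · exact P.dual_notMem hx hy.2.2 }

section dualize

variable (P : IndexSet n m) {p s : ℕ} (hp : p ∈ P.carrier) (hs : s ∈ P.carrier) (hps : p ≠ s)

lemma mem_dualize (x : ℕ) : x ∈ (P.dualize p s hp hs hps).carrier ↔
    x = 2 * n + 3 - p ∨ x = 2 * n + 3 - s ∨ (x ≠ s ∧ x ≠ p ∧ x ∈ P.carrier) := by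
  simp [dualize]

lemma cnt_dualize (k : ℕ) :
    cnt (P.dualize p s hp hs hps).carrier k + (if p ≤ k then 1 else 0) + (if s ≤ k then 1 else 0) =
      cnt P.carrier k + (if 2 * n + 3 - p ≤ k then 1 else 0) +
        (if 2 * n + 3 - s ≤ k then 1 else 0) := by
  have hbp := P.mem_bounds hp
  have hbs := P.mem_bounds hs
  have hp' := P.dual_notMem hp
  have hs' := P.dual_notMem hs
  have h1 : s ∈ P.carrier.erase p := Finset.mem_erase.2 ⟨hps.symm, hs⟩
  change cnt (insert (2 * n + 3 - p) (insert (2 * n + 3 - s) ((P.carrier.erase p).erase s))) k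
    + _ + _ = _
  have e1 := cnt_erase hp hbp.1 k
  have e2 := cnt_erase h1 hbs.1 k
  rw [cnt_insert, cnt_insert]
  · omega
  · simp only [Finset.mem_erase]; tauto
  · omega
  · simp only [Finset.mem_insert, Finset.mem_erase]
    have : 2 * n + 3 - p ≠ 2 * n + 3 - s := by omega
    tauto
  · omega

lemma move_dualize (h : 2 * n + 3 < p + s) : Move P (P.dualize p s hp hs hps) := by
  have hbp := P.mem_bounds hp
  have hbs := P.mem_bounds hs
  refine ⟨p, 2 * n + 3 - s, by omega, by omega, by omega, hp, fun i hi => ?_⟩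
  have hss : 2 * n + 3 - (2 * n + 3 - s) = s := by omega
  rw [hss]
  rcases (P.mem_dualize hp hs hps i).1 hi with rfl | rfl | ⟨h1, h2, h3⟩
  · exact Or.inr (Or.inl ⟨rfl, hs⟩)
  · exact Or.inl rfl
  · refine Or.inr (Or.inr ⟨h3, h2, ?_, ?_, h1⟩)
    · rintro rfl; exact P.dual_notMem hs h3
    · rintro rfl; exact P.dual_notMem hp h3

end dualize

/-- A move for which the type is controlled. -/
structure Step (P R : IndexSet n m) : Prop where
  move : Move P R
  cnt_le : ∀ k, cnt P.carrier k ≤ cnt R.carrier k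
  cnt_lt : ∃ k, k ≠ n + 1 ∧ k < 2 * n + 3 ∧ cnt P.carrier k < cnt R.carrier k
  type_eq : P.type ≠ 0 → R.type ≠ 0 → R.type = P.type
  move_iota : P.type = 0 → Move P R.iota

lemma type_ne_zero_iff (P : IndexSet n m) :
    P.type ≠ 0 ↔ (n + 1 ∈ P.carrier ∧ n + 2 ∉ P.carrier) ∨
      (n + 1 ∉ P.carrier ∧ n + 2 ∈ P.carrier) := by
  rw [Ne, type_eq_zero_iff]
  have : n + 1 ∈ P.carrier → n + 2 ∉ P.carrier := by
    intro h
    have := P.dual_notMem h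
    rwa [show 2 * n + 3 - (n + 1) = n + 2 by omega] at this
  tauto

/-- If both types are positive, neither `p` nor `q` is `n + 1` or `n + 2`, and `ht` keeps them on
the same side of the middle; so the count at `n + 1`, and with it the type, is unchanged. -/
lemma step_replace (P : IndexSet n m) {p q : ℕ} (hp : p ∈ P.carrier) (hq1 : 1 ≤ q)
    (hq2 : q ≤ 2 * n + 2) (hq : q ∉ P.carrier) (hq' : 2 * n + 3 - q ∉ P.carrier)
    (h : q < p) (ht : P.type ≠ 0 → n + 1 ≤ q ∨ p ≤ n + 2) :
    Step P (P.replace p q hp hq1 hq2 hq hq') := by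
  have hb := P.mem_bounds hp
  have hpq := P.add_ne_of_dual_notMem hp hq'
  have hcnt := P.cnt_replace hp hq1 hq2 hq hq'
  have hmem := P.mem_replace hp hq1 hq2 hq hq'
  refine ⟨P.move_replace hp hq1 hq2 hq hq' h, fun k => ?_, ?_, fun hP hR => ?_, fun hP => ?_⟩
  · have := hcnt k
    split_ifs at this <;> omega
  · by_cases hqn : q = n + 1
    · refine ⟨n + 2, by omega, by omega, ?_⟩
      have := hcnt (n + 2)
      rw [if_neg (by omega), if_pos (by omega)] at this
      omega
    · refine ⟨q, hqn, by omega, ?_⟩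
      have := hcnt q
      rw [if_neg (by omega), if_pos le_rfl] at this
      omega
  · rw [type_eq_iff P _ hP hR]
    have h1 := ht hP
    have h2 := (type_ne_zero_iff _).1 hP
    have h3 := (type_ne_zero_iff _).1 hR
    simp only [hmem] at h3
    have hqa : q ≠ n + 1 := by
      rintro rfl
      rw [show 2 * n + 3 - (n + 1) = n + 2 by omega] at hq'
      tauto
    have hqb : q ≠ n + 2 := by
      rintro rfl
      rw [show 2 * n + 3 - (n + 2) = n + 1 by omega] at hq'
      tauto
    have hpa : p ≠ n + 1 := by
      rintro rfl
      rcases h2 with h2 | h2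
      · rcases h3 with h3 | h3 <;> simp [h2, hqa.symm, hqb.symm] at h3
      · exact h2.1 hp
    have hpb : p ≠ n + 2 := by
      rintro rfl
      rcases h2 with h2 | h2
      · exact h2.2 hp
      · rcases h3 with h3 | h3 <;> simp [h2, hqa.symm, hqb.symm] at h3
    have := hcnt (n + 1)
    unfold Nat.ModEq
    split_ifs at this <;> omega
  · by_cases hqn : q = n + 1 ∨ q = n + 2
    -- When `q` is a middle element, applying `ι` to the result amounts to replacing `p` by the
    -- other middle element `N + 1 - q`.
    · have hpn : p ≠ n + 1 ∧ p ≠ n + 2 := by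
        rw [type_eq_zero_iff] at hP
        constructor <;> rintro rfl <;> tauto
      refine ⟨p, 2 * n + 3 - q, by omega, by omega, by omega, hp, fun i hi => ?_⟩
      rw [mem_iota, hmem] at hi
      rcases hi with hi | ⟨hi1, hi2⟩
      · left
        rw [Equiv.swap_apply_def] at hi
        split_ifs at hi <;> omega
      · right; right
        rw [type_eq_zero_iff] at hP
        have hia : i ≠ n + 1 := by
          rintro rfl
          rw [Equiv.swap_apply_left] at hi2
          tauto
        have hib : i ≠ n + 2 := by
          rintro rfl
          rw [Equiv.swap_apply_right] at hi2
          tauto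
        rw [Equiv.swap_apply_of_ne_of_ne hia hib] at hi1 hi2
        refine ⟨hi2, hi1, by omega, ?_, by omega⟩
        rintro rfl
        exact P.dual_notMem hp hi2
    · rw [iota_eq_self]
      · exact P.move_replace hp hq1 hq2 hq hq' h
      · rw [type_eq_zero_iff] at hP ⊢
        rw [hmem, hmem]
        refine ⟨?_, ?_⟩ <;> rintro (h | h)
        · omega
        · tauto
        · omega
        · tauto

/-- As `p + s > N + 1`, at most one of `p`, `s` is at most `n + 1`; the count at `n + 1` grows by
`0` or `2`, which preserves parity. -/
lemma step_dualize (P : IndexSet n m) {p s : ℕ} (hp : p ∈ P.carrier) (hs : s ∈ P.carrier)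
    (hps : p ≠ s) (h : 2 * n + 3 < p + s) : Step P (P.dualize p s hp hs hps) := by
  have hbp := P.mem_bounds hp
  have hbs := P.mem_bounds hs
  have hcnt := P.cnt_dualize hp hs hps
  have hmem := P.mem_dualize hp hs hps
  have hmove := P.move_dualize hp hs hps h
  have hle : ∀ k, cnt P.carrier k ≤ cnt (P.dualize p s hp hs hps).carrier k := fun k => by
    have := hcnt k
    split_ifs at this <;> omega
  refine ⟨hmove, hle, ?_, fun hP hR => ?_, fun hP => ?_⟩
  · by_cases h1 : p = n + 2 ∨ s = n + 2
    · refine ⟨n + 2, by omega, by omega, ?_⟩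
      have := hcnt (n + 2)
      split_ifs at this <;> omega
    · refine ⟨2 * n + 3 - max p s, by omega, by omega, ?_⟩
      have := hcnt (2 * n + 3 - max p s)
      split_ifs at this <;> omega
  · rw [type_eq_iff P _ hP hR]
    have := hcnt (n + 1)
    unfold Nat.ModEq
    split_ifs at this <;> omega
  · rw [iota_eq_self]
    · exact hmove
    · rw [type_eq_zero_iff] at hP ⊢
      have h1 : p ≠ n + 1 ∧ p ≠ n + 2 := by
        constructor <;> rintro rfl <;> tauto
      have h2 : s ≠ n + 1 ∧ s ≠ n + 2 := by
        constructor <;> rintro rfl <;> tauto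
      rw [hmem, hmem]
      refine ⟨?_, ?_⟩ <;> rintro (h | h | h)
      · omega
      · omega
      · tauto
      · omega
      · omega
      · tauto

/-- Take the least `q` where `P` and `Q` differ; it lies in `Q`. If `N + 1 - q ∉ P`, lower the next
element of `P` to `q`. Otherwise lower `N + 1 - q` to the nearest gap `r` of `P` below it, and if `N
+ 1 - r ∈ P` lower that element to `q` at the same time. Only `Q ≤ R` is claimed; the types may go
wrong. -/
lemma exists_step {Q P : IndexSet n m} (h : Q.Prec P) (hne : Q ≠ P) :
    ∃ R, Step P R ∧ Q.Le R := by
  obtain ⟨hle, hcrit⟩ := h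
  rw [le_iff_cnt] at hle
  have hex : ∃ x, ¬ (x ∈ P.carrier ↔ x ∈ Q.carrier) := by
    by_contra! hcon
    exact hne (IndexSet.ext (Finset.ext fun x => (hcon x).symm))
  classical
  obtain ⟨q, hq, hmin⟩ : ∃ q, ¬ (q ∈ P.carrier ↔ q ∈ Q.carrier) ∧
      ∀ x < q, x ∈ P.carrier ↔ x ∈ Q.carrier :=
    ⟨Nat.find hex, Nat.find_spec hex, fun x hx => not_not.1 (Nat.find_min hex hx)⟩
  have hq1 : 1 ≤ q := by
    by_contra h0
    obtain rfl : q = 0 := by omega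
    apply hq
    constructor <;> intro h
    · have := P.mem_bounds h; omega
    · have := Q.mem_bounds h; omega
  have hcq : cnt P.carrier (q - 1) = cnt Q.carrier (q - 1) :=
    cnt_congr fun x hx => hmin x (by omega)
  have hP1 := cnt_pred P.carrier hq1
  have hQ1 := cnt_pred Q.carrier hq1
  have hqP : q ∉ P.carrier := by
    intro h
    have h' : q ∉ Q.carrier := by tauto
    have := hle q
    simp only [h, h', if_true, if_false] at hP1 hQ1
    omega
  have hqQ : q ∈ Q.carrier := by tauto
  have hq2 := (Q.mem_bounds hqQ).2
  simp only [hqP, hqQ, if_true, if_false] at hP1 hQ1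
  by_cases hq' : 2 * n + 3 - q ∈ P.carrier
  swap
  · -- lower the next element of `P` to `q`
    have hex2 : ∃ p, q < p ∧ p ∈ P.carrier := by
      by_contra! hcon
      have h1 := cnt_eq_of_disjoint (S := P.carrier) hq2 fun x h1 _ => hcon x h1
      have h2 := cnt_mono Q.carrier hq2
      rw [P.cnt_top le_rfl] at h1
      rw [Q.cnt_top le_rfl] at h2
      omega
    obtain ⟨p, ⟨hqp, hpP⟩, hpmin⟩ : ∃ p, (q < p ∧ p ∈ P.carrier) ∧
        ∀ x, q < x → x < p → x ∉ P.carrier :=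
      ⟨Nat.find hex2, Nat.find_spec hex2, fun x h1 h2 h3 => Nat.find_min hex2 h2 ⟨h1, h3⟩⟩
    refine ⟨_, P.step_replace hpP hq1 hq2 hqP hq' hqp ?_, ?_⟩
    · intro hP
      by_contra! hcon
      have h1 := hpmin (n + 1) (by omega) (by omega)
      have h2 := hpmin (n + 2) (by omega) (by omega)
      exact hP ((type_eq_zero_iff P).2 ⟨h1, h2⟩)
    · rw [le_iff_cnt]
      intro k
      have h1 := P.cnt_replace hpP hq1 hq2 hqP hq' k
      have h2 := hle k
      by_cases hk : q ≤ k ∧ k < p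
      · have h3 := cnt_eq_of_disjoint (S := P.carrier) hk.1 fun x h1 h2 => hpmin x h1 (by omega)
        have h4 := cnt_mono Q.carrier hk.1
        rw [if_neg (by omega), if_pos (by omega)] at h1
        omega
      · split_ifs at h1 <;> omega
  · have hq'Q := Q.dual_notMem hqQ
    have hqn : q ≤ n + 1 := by
      by_contra hcon
      exact hq'Q ((hmin _ (by omega)).1 hq')
    rcases hqn.eq_or_lt with rfl | hqn
    · -- the pair is critical, but the types differ
      exfalso
      rw [show 2 * n + 3 - (n + 1) = n + 2 by omega] at hq' hq'Q
      have hc : Q.Critical P := (critical_iff Q P).2 ⟨n + 1, by omega, le_rfl, by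
        intro x h1 h2
        obtain rfl : x = n + 1 := by omega
        rw [show 2 * n + 3 - (n + 1) = n + 2 by omega]
        exact Or.inr hq', by
        intro x h1 h2
        obtain rfl : x = n + 1 := by omega
        exact Or.inl hqQ, hcq.symm⟩
      have := (type_eq_iff P Q hc.type_ne_zero.2 hc.type_ne_zero.1).1 (hcrit hc)
      unfold Nat.ModEq at this
      omega
    have hP12 : n + 1 ∈ P.carrier → n + 2 ∉ P.carrier := by
      intro h
      have := P.dual_notMem h
      rwa [show 2 * n + 3 - (n + 1) = n + 2 by omega] at this
    -- the largest gap of `P` below the dual of `q`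
    obtain ⟨r, hr1, hr2, hrP, hrmax⟩ : ∃ r, n + 1 ≤ r ∧ r < 2 * n + 3 - q ∧ r ∉ P.carrier ∧
        ∀ x, r < x → x ≤ 2 * n + 3 - q → x ∈ P.carrier := by
      -- The dual elements `n + 1` and `n + 2` are not both in `P`, so a gap occurs before passing
      -- the middle.
      have hex3 : ∃ d, 2 * n + 3 - q - d ∉ P.carrier ∧ n + 1 ≤ 2 * n + 3 - q - d := by
        by_cases h : n + 1 ∈ P.carrier
        · refine ⟨n + 1 - q, ?_, by omega⟩
          rw [show 2 * n + 3 - q - (n + 1 - q) = n + 2 by omega]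
          exact hP12 h
        · refine ⟨n + 2 - q, ?_, by omega⟩
          rwa [show 2 * n + 3 - q - (n + 2 - q) = n + 1 by omega]
      obtain ⟨h1, h2⟩ := Nat.find_spec hex3
      refine ⟨_, h2, ?_, h1, ?_⟩
      · rcases Nat.eq_zero_or_pos (Nat.find hex3) with h0 | h0
        · rw [h0] at h1
          exact absurd hq' h1
        · omega
      · intro x hx1 hx2
        by_contra hx
        have := Nat.find_min' hex3 (m := 2 * n + 3 - q - x) ⟨by
          rwa [show 2 * n + 3 - q - (2 * n + 3 - q - x) = x by omega], by omega⟩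
        omega
    -- Reading down from `N + 1 - q`: `P` contains all of `(k, N + 1 - q]`, whereas `Q` misses `N +
    -- 1 - q`.
    have hgap : ∀ k, r ≤ k → k < 2 * n + 3 - q → cnt P.carrier k + 1 ≤ cnt Q.carrier k := by
      intro k hk1 hk2
      have h1 := cnt_eq_of_subset (S := P.carrier) hk2.le fun x h1 h2 => hrmax x (by omega) h2
      have h2 := cnt_le_add Q.carrier (show k ≤ 2 * n + 3 - q - 1 by omega)
      have h3 := cnt_pred Q.carrier (show 1 ≤ 2 * n + 3 - q by omega)
      rw [if_neg hq'Q] at h3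
      have h4 := hle (2 * n + 3 - q)
      omega
    by_cases hr' : 2 * n + 3 - r ∈ P.carrier
    swap
    · refine ⟨_, P.step_replace hq' (by omega) (by omega) hrP hr' hr2
        (fun _ => Or.inl hr1), ?_⟩
      rw [le_iff_cnt]
      intro k
      have h1 := P.cnt_replace hq' (show 1 ≤ r by omega) (by omega) hrP hr' k
      have h2 := hle k
      by_cases hk : r ≤ k ∧ k < 2 * n + 3 - q
      · have := hgap k hk.1 hk.2
        rw [if_neg (by omega), if_pos (by omega)] at h1
        omega
      · split_ifs at h1 <;> omega
    · have hlow : ∀ x, q < x → x < 2 * n + 3 - r → x ∉ P.carrier := by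
        intro x h1 h2 h3
        exact P.dual_notMem h3 (hrmax _ (by omega) (by omega))
      have hlow' : ∀ k, q ≤ k → k < 2 * n + 3 - r → cnt P.carrier k = cnt P.carrier q :=
        fun k h1 h2 => cnt_eq_of_disjoint h1 fun x h3 h4 => hlow x h3 (by omega)
      -- Dualizing raises the count on `[q, N + 1 - r)` and on `[r, N + 1 - q)`. These overlap only
      -- for `r = n + 1`, at the single point `n + 1`, where a surplus of two is required.
      have hmid : r = n + 1 → cnt P.carrier (n + 1) + 2 ≤ cnt Q.carrier (n + 1) := by
        -- otherwise the pair is critical, but the types differ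
        intro hr
        by_contra hcon
        have h0 := hlow' (n + 1) (by omega) (by omega)
        have h1 := cnt_mono Q.carrier (show q ≤ n + 1 by omega)
        have hPs : ∀ x, q ≤ x → x ≤ n + 1 → x ∈ P.carrier ∨ 2 * n + 3 - x ∈ P.carrier :=
          fun x h1 h2 => Or.inr (hrmax _ (by omega) (by omega))
        have hmP := (P.cnt_middle (n + 2 - q) (by omega)).2
        have hmQ := Q.cnt_middle (n + 2 - q) (by omega)
        rw [show n + 2 - (n + 2 - q) = q by omega, show n + 1 - (n + 2 - q) = q - 1 by omega]
          at hmP hmQ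
        have h5 := hle (n + 1 + (n + 2 - q))
        have h6 := hmP.2 hPs
        have hc : Q.Critical P := (critical_iff Q P).2
          ⟨q, hq1, by omega, hPs, hmQ.2.1 (by omega), hcq.symm⟩
        have := (type_eq_iff P Q hc.type_ne_zero.2 hc.type_ne_zero.1).1 (hcrit hc)
        unfold Nat.ModEq at this
        omega
      refine ⟨_, P.step_dualize hr' hq' (by omega) ?_, ?_⟩
      · have : r ≠ n + 1 + (n + 1 - q) + 1 := by omega
        omega
      · rw [le_iff_cnt]
        intro k
        have h1 := P.cnt_dualize hr' hq' (by omega) k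
        rw [show 2 * n + 3 - (2 * n + 3 - r) = r by omega,
          show 2 * n + 3 - (2 * n + 3 - q) = q by omega] at h1
        have h2 := hle k
        have h3 := hgap k
        have h4 := hlow' k
        have h5 := fun h => cnt_mono Q.carrier (k := q) (l := k) h
        by_cases hk : k = n + 1
        · subst hk
          by_cases hr : r = n + 1
          · have := hmid hr
            split_ifs at h1 <;> omega
          · split_ifs at h1 <;> omega
        · split_ifs at h1 <;> omega

/-- If the types are positive and differ, then one can pass through an index set of type `0`. -/
lemma exists_type_zero_between {Q P : IndexSet n m} (hm : m < n + 1) (h : Q.Prec P)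
    (hQ : Q.type ≠ 0) (hP : P.type ≠ 0) (hne : Q.type ≠ P.type) :
    (∃ R, Move P R ∧ R.type = 0 ∧ Q.Le R ∧ R.Le P ∧ R ≠ P) ∨
      ∃ R, Move R Q ∧ R.type = 0 ∧ R.Le P ∧ Q.Le R ∧ R ≠ Q := by
  obtain ⟨hle, hcrit⟩ := h
  rw [le_iff_cnt] at hle
  have hnc : ¬ Q.Critical P := fun hc => hne (hcrit hc)
  rw [critical_iff] at hnc
  have hmP : ∀ T : IndexSet n m, T.type ≠ 0 → n + 1 ∈ T.carrier ∨ 2 * n + 3 - (n + 1) ∈ T.carrier := by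
    intro T hT
    rw [show 2 * n + 3 - (n + 1) = n + 2 by omega]
    have := (type_ne_zero_iff T).1 hT
    tauto
  let K : ℕ → Prop := fun c => 1 ≤ c ∧ c ≤ n + 1 ∧
      (∀ x, c ≤ x → x ≤ n + 1 → x ∈ P.carrier ∨ 2 * n + 3 - x ∈ P.carrier) ∧
      (∀ x, c ≤ x → x ≤ n + 1 → x ∈ Q.carrier ∨ 2 * n + 3 - x ∈ Q.carrier)
  have hex : ∃ c, K c := by
    refine ⟨n + 1, by omega, le_rfl, ?_, ?_⟩ <;> intro x h1 h2 <;>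
      obtain rfl : x = n + 1 := by omega
    · exact hmP P hP
    · exact hmP Q hQ
  classical
  obtain ⟨c, ⟨hc1, hc2, hcP, hcQ⟩, hmin⟩ : ∃ c, K c ∧ ∀ x < c, ¬ K x :=
    ⟨Nat.find hex, Nat.find_spec hex, fun x hx => Nat.find_min hex hx⟩
  -- If `c = 1`, then `[P]` contains `[1, n + 1]` and `P` has `n + 1` elements, against `m < n + 1`.
  have hc : 2 ≤ c := by
    by_contra hcon
    obtain rfl : c = 1 := by omega
    have := (P.cnt_middle (n + 1) le_rfl).2
    rw [show n + 2 - (n + 1) = 1 by omega, show n + 1 - (n + 1) = 0 by omega, cnt_zero,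
      P.cnt_top (by omega)] at this
    have := this.2 hcP
    omega
  -- Equality of counts at `k` would make `k + 1` a critical index.
  have hD : ∀ k, c ≤ k + 1 → k + 1 ≤ n + 1 → cnt P.carrier k + 1 ≤ cnt Q.carrier k := by
    intro k h1 h2
    by_contra hcon
    exact hnc ⟨k + 1, by omega, h2, fun x hx => hcP x (by omega), fun x hx => hcQ x (by omega), by
      have := hle k
      simp only [add_tsub_cancel_right]
      omega⟩
  have hPs := cnt_succ P.carrier n
  have hQs := cnt_succ Q.carrier n
  have hDn := hD n (by omega) le_rfl
  -- By minimality of `c`, the dual pair of `c - 1` is free in `P` or in `Q`. The middle element is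
  -- moved there: down to `c - 1` in `P`, or up to `N + 2 - c` in `Q`. Either way the result has
  -- type `0`, and the surplus of `Q` absorbs the change.
  have hfail : (c - 1 ∉ P.carrier ∧ 2 * n + 3 - (c - 1) ∉ P.carrier) ∨
      (c - 1 ∉ Q.carrier ∧ 2 * n + 3 - (c - 1) ∉ Q.carrier) := by
    by_contra! hcon
    refine hmin (c - 1) (by omega) ⟨by omega, by omega, ?_, ?_⟩ <;> intro x h1 h2
    · by_cases hx : x = c - 1
      · subst hx; tauto
      · exact hcP x (by omega) h2
    · by_cases hx : x = c - 1
      · subst hx; tauto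
      · exact hcQ x (by omega) h2
  rcases hfail with ⟨h1, h2⟩ | ⟨h1, h2⟩
  · left
    obtain ⟨p, hp, hp1⟩ : ∃ p, p ∈ P.carrier ∧ (p = n + 1 ∨ (p = n + 2 ∧ n + 1 ∉ P.carrier)) := by
      have := (type_ne_zero_iff P).1 hP
      by_cases h : n + 1 ∈ P.carrier
      · exact ⟨_, h, Or.inl rfl⟩
      · exact ⟨n + 2, by tauto, Or.inr ⟨rfl, h⟩⟩
    have hmem := P.mem_replace hp (show 1 ≤ c - 1 by omega) (by omega) h1 h2
    have hcnt := P.cnt_replace hp (show 1 ≤ c - 1 by omega) (by omega) h1 h2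
    refine ⟨P.replace p (c - 1) hp (by omega) (by omega) h1 h2,
      P.move_replace hp _ _ h1 h2 (by omega), ?_, ?_, ?_, ?_⟩
    · rw [type_eq_zero_iff, hmem, hmem]
      have := (type_ne_zero_iff P).1 hP
      refine ⟨?_, ?_⟩ <;> rintro (h | ⟨h3, h4⟩) <;> first | omega | skip
      · rcases hp1 with rfl | ⟨rfl, h5⟩ <;> tauto
      · rcases hp1 with rfl | ⟨rfl, h5⟩ <;> tauto
    · rw [le_iff_cnt]
      intro k
      have h3 := hcnt k
      have h4 := hD k
      have h5 := hle k
      by_cases hk : k = n + 1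
      · subst hk
        rcases hp1 with rfl | ⟨rfl, h6⟩
        · split_ifs at h3 <;> omega
        · rw [if_neg h6] at hPs
          split_ifs at h3 <;> omega
      · split_ifs at h3 <;> omega
    · rw [le_iff_cnt]
      intro k
      have h3 := hcnt k
      split_ifs at h3 <;> omega
    · intro h
      have := (hmem (c - 1)).2 (Or.inl rfl)
      rw [h] at this
      exact h1 this
  · right
    obtain ⟨p, hp, hp1⟩ : ∃ p, p ∈ Q.carrier ∧ ((p = n + 1 ∧ n + 1 ∈ Q.carrier) ∨ p = n + 2) := by
      have := (type_ne_zero_iff Q).1 hQ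
      by_cases h : n + 1 ∈ Q.carrier
      · exact ⟨_, h, Or.inl ⟨rfl, h⟩⟩
      · exact ⟨n + 2, by tauto, Or.inr rfl⟩
    -- Both sets have the maximal count in every symmetric interval inside `[c, N + 1 - c]`, so the
    -- surplus in `hD` is reflected across the middle.
    have hD' : ∀ k, n + 2 ≤ k → k ≤ 2 * n + 3 - c → cnt P.carrier k + 1 ≤ cnt Q.carrier k := by
      intro k hk1 hk2
      have e1 := (P.cnt_middle (k - (n + 1)) (by omega)).2.2 fun x hx => hcP x (by omega)
      have e2 := (Q.cnt_middle (k - (n + 1)) (by omega)).2.2 fun x hx => hcQ x (by omega)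
      have e3 := hD (n + 1 - (k - (n + 1))) (by omega) (by omega)
      rw [show n + 1 + (k - (n + 1)) = k by omega] at e1 e2
      omega
    have h1' : 2 * n + 3 - (2 * n + 3 - (c - 1)) ∉ Q.carrier := by
      rwa [show 2 * n + 3 - (2 * n + 3 - (c - 1)) = c - 1 by omega]
    have hmem := Q.mem_replace hp (show 1 ≤ 2 * n + 3 - (c - 1) by omega) (by omega) h2 h1'
    have hcnt := Q.cnt_replace hp (show 1 ≤ 2 * n + 3 - (c - 1) by omega) (by omega) h2 h1'
    refine ⟨Q.replace p (2 * n + 3 - (c - 1)) hp (by omega) (by omega) h2 h1',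
      Q.move_of_replace hp _ _ h2 h1' (by omega), ?_, ?_, ?_, ?_⟩
    · rw [type_eq_zero_iff, hmem, hmem]
      have := (type_ne_zero_iff Q).1 hQ
      refine ⟨?_, ?_⟩ <;> rintro (h | ⟨h3, h4⟩) <;> first | omega | skip
      · rcases hp1 with ⟨rfl, h5⟩ | rfl <;> tauto
      · rcases hp1 with ⟨rfl, h5⟩ | rfl <;> tauto
    · rw [le_iff_cnt]
      intro k
      have h3 := hcnt k
      have h4 := hD' k
      have h5 := hle k
      by_cases hk : k = n + 1
      · subst hk
        rcases hp1 with ⟨rfl, h6⟩ | rfl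
        · rw [if_pos h6] at hQs
          split_ifs at h3 hPs <;> omega
        · split_ifs at h3 <;> omega
      · split_ifs at h3 <;> omega
    · rw [le_iff_cnt]
      intro k
      have h3 := hcnt k
      split_ifs at h3 <;> omega
    · intro h
      have := (hmem (2 * n + 3 - (c - 1))).2 (Or.inl rfl)
      rw [h] at this
      exact h2 this

/-- The sum of the values of the counting function. -/
def weight (P : IndexSet n m) : ℕ := ∑ k ∈ Finset.range (2 * n + 3), cnt P.carrier k

lemma weight_le {P R : IndexSet n m} (h : R.Le P) : P.weight ≤ R.weight :=
  Finset.sum_le_sum fun k _ => (le_iff_cnt R P).1 h k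

lemma weight_lt_of_cnt {P R : IndexSet n m} (h : R.Le P) {k : ℕ} (hk : k < 2 * n + 3)
    (hlt : cnt P.carrier k < cnt R.carrier k) : P.weight < R.weight :=
  Finset.sum_lt_sum (fun k _ => (le_iff_cnt R P).1 h k) ⟨k, Finset.mem_range.2 hk, hlt⟩

lemma weight_lt {P R : IndexSet n m} (h : R.Le P) (hne : R ≠ P) : P.weight < R.weight := by
  by_contra hcon
  apply hne
  have hle := (le_iff_cnt R P).1 h
  have heq : ∀ k, cnt P.carrier k = cnt R.carrier k := by
    intro k
    by_cases hk : k < 2 * n + 3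
    · by_contra hk'
      exact hcon (weight_lt_of_cnt h hk (lt_of_le_of_ne (hle k) hk'))
    · rw [P.cnt_top (by omega), R.cnt_top (by omega)]
  ext x
  rcases Nat.eq_zero_or_pos x with rfl | hx
  · constructor <;> intro h
    · have := R.mem_bounds h; omega
    · have := P.mem_bounds h; omega
  · have h1 := cnt_pred P.carrier hx
    have h2 := cnt_pred R.carrier hx
    rw [heq, heq, h2] at h1
    by_cases a : x ∈ P.carrier <;> by_cases b : x ∈ R.carrier <;> simp [a, b] at h1 ⊢

/-- Induction on the difference of weights. If a step to `R` loses `Q ⪯ R`, the types of `Q` and `R`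
are positive and distinct. If `P` has type `0`, then `ι(R)` is an equally good target. Otherwise `P`
has the type of `R`, so `Q` and `P` differ in type and a set of type `0` can be inserted next to one
end. -/
lemma reachable_of_prec (hm : m < n + 1) {Q P : IndexSet n m} (h : Q.Prec P) :
    Relation.ReflTransGen Move P Q := by
  induction hw : Q.weight - P.weight using Nat.strong_induction_on generalizing P Q with
  | _ w ih =>
    subst hw
    by_cases hne : Q = P
    · subst hne; exact Relation.ReflTransGen.refl
    have down : ∀ R, Move P R → Q.Prec R → P.weight < R.weight →
        Relation.ReflTransGen Move P Q := by
      intro R h1 h2 h3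
      have := weight_le h2.1
      exact Relation.ReflTransGen.head h1 (ih _ (by omega) h2 rfl)
    obtain ⟨R, hstep, hQR⟩ := exists_step h hne
    have hRP : R.Le P := (le_iff_cnt _ _).2 hstep.cnt_le
    obtain ⟨k, hk1, hk2, hk3⟩ := hstep.cnt_lt
    have hw := weight_lt_of_cnt hRP hk2 hk3
    by_cases hQR' : Q.Prec R
    · exact down R hstep.move hQR' hw
    have hQ : Q.type ≠ 0 := fun h0 => hQR' (prec_of_type_zero hQR (Or.inl h0))
    have hR : R.type ≠ 0 := fun h0 => hQR' (prec_of_type_zero hQR (Or.inr h0))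
    have hQRne : Q.type ≠ R.type := fun h0 => hQR' ⟨hQR, fun _ => h0⟩
    by_cases hP : P.type = 0
    · have hprec := (prec_or_prec_iota Q R (fun k _ => (le_iff_cnt _ _).1 hQR k) hR).resolve_left
        hQR'
      refine down R.iota (hstep.move_iota hP) hprec (weight_lt_of_cnt ?_ hk2
        (by rwa [cnt_iota _ hk1]))
      rw [le_iff_cnt]
      intro l
      by_cases hl : l = n + 1
      · subst hl
        rw [cnt_succ P.carrier n, if_neg ((type_eq_zero_iff P).1 hP).1]
        have h1 := hstep.cnt_le n
        have h2 := cnt_mono R.iota.carrier (show n ≤ n + 1 by omega)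
        rw [cnt_iota _ (by omega)] at h2
        omega
      · rw [cnt_iota _ hl]
        exact hstep.cnt_le l
    · have hQP : Q.type ≠ P.type := fun h0 => hQRne (h0.trans (hstep.type_eq hP hR).symm)
      rcases exists_type_zero_between hm h hQ hP hQP with
        ⟨T, h1, h2, h3, h4, h5⟩ | ⟨T, h1, h2, h3, h4, h5⟩
      · exact down T h1 (prec_of_type_zero h3 (Or.inr h2)) (weight_lt h4 h5)
      · have h6 := weight_lt h4 (Ne.symm h5)
        have h7 := weight_le h3
        exact Relation.ReflTransGen.tail
          (ih (T.weight - P.weight) (by omega) (prec_of_type_zero h3 (Or.inl h2)) rfl) h1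

end IndexSet

end EvenOG

/-! ### Coordinates in the adapted basis. -/

namespace EvenOG

variable {V : Type*} [AddCommGroup V] [Module ℂ V] {n m : ℕ}

section coordinates

/-- The index `N + 1 - i`. -/
def dual (i : Idx (2 * n + 2)) : Idx (2 * n + 2) :=
  ⟨2 * n + 3 - i, by
    have := Finset.mem_Icc.1 i.2
    rw [Finset.mem_Icc]
    omega⟩

lemma idx_bounds {N : ℕ} (i : Idx N) : 1 ≤ (i : ℕ) ∧ (i : ℕ) ≤ N := Finset.mem_Icc.1 i.2

lemma coe_dual (i : Idx (2 * n + 2)) : (dual i : ℕ) = 2 * n + 3 - i := rfl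

lemma dual_dual (i : Idx (2 * n + 2)) : dual (dual i) = i := by
  have := idx_bounds i
  apply Subtype.ext
  rw [coe_dual, coe_dual]
  omega

lemma dual_injective : Function.Injective (dual (n := n)) :=
  Function.LeftInverse.injective dual_dual

lemma dual_ne_self (i : Idx (2 * n + 2)) : dual i ≠ i := by
  have := idx_bounds i
  intro h
  have := congrArg Subtype.val h
  rw [coe_dual] at this
  omega

lemma dual_eq_iff (i j : Idx (2 * n + 2)) : dual i = j ↔ i = dual j := by
  constructor
  · rintro rfl; rw [dual_dual]
  · rintro rfl; rw [dual_dual]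

lemma mem_span_basis_image {N : ℕ} (e : Module.Basis (Idx N) ℂ V) (A : Set (Idx N)) (x : V) :
    x ∈ Submodule.span ℂ (e '' A) ↔ ∀ i, i ∉ A → e.repr x i = 0 := by
  rw [Module.Basis.mem_span_image]
  constructor
  · intro h i hi
    by_contra h0
    exact hi (h (Finsupp.mem_support_iff.2 h0))
  · intro h i hi
    by_contra h0
    exact Finsupp.mem_support_iff.1 hi (h i h0)

lemma finrank_span_basis_image {N : ℕ} (e : Module.Basis (Idx N) ℂ V) (A : Set (Idx N)) :
    Module.finrank ℂ (Submodule.span ℂ (e '' A)) = A.ncard := by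
  classical
  have h := finrank_span_eq_card (R := ℂ) (b := fun i : A => e i)
    (e.linearIndependent.comp _ Subtype.val_injective)
  rw [show Set.range (fun i : A => e i) = e '' A by
    rw [Set.image_eq_range]] at h
  rw [h, ← Nat.card_eq_fintype_card]
  rfl

lemma span_basis_image_inf {N : ℕ} (e : Module.Basis (Idx N) ℂ V) (A B : Set (Idx N)) :
    Submodule.span ℂ (e '' A) ⊓ Submodule.span ℂ (e '' B) = Submodule.span ℂ (e '' (A ∩ B)) := by
  ext x
  simp only [Submodule.mem_inf, mem_span_basis_image, Set.mem_inter_iff, not_and_or]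
  constructor
  · rintro ⟨h1, h2⟩ i (h | h)
    · exact h1 i h
    · exact h2 i h
  · intro h
    exact ⟨fun i hi => h i (Or.inl hi), fun i hi => h i (Or.inr hi)⟩

lemma span_basis_image_sup {N : ℕ} (e : Module.Basis (Idx N) ℂ V) (A B : Set (Idx N)) :
    Submodule.span ℂ (e '' A) ⊔ Submodule.span ℂ (e '' B) = Submodule.span ℂ (e '' (A ∪ B)) := by
  rw [Set.image_union, Submodule.span_union]

lemma repr_self_apply {N : ℕ} (e : Module.Basis (Idx N) ℂ V) (i j : Idx N) :
    e.repr (e i) j = if i = j then 1 else 0 := by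
  rw [Module.Basis.repr_self_apply]

end coordinates

section adapted

variable {b : LinearMap.BilinForm ℂ V} {F : ℕ → Submodule ℂ V}
  {e : Module.Basis (Idx (2 * n + 2)) ℂ V}

lemma IsAdapted.mem_flag (he : IsAdapted b (2 * n + 2) F e) {p : ℕ} (hp : p ≤ 2 * n + 2) (x : V) :
    x ∈ F p ↔ ∀ i : Idx (2 * n + 2), p < i → e.repr x i = 0 := by
  rw [he.flag p hp, mem_span_basis_image]
  simp

lemma IsAdapted.apply_basis_left (he : IsAdapted b (2 * n + 2) F e) (i : Idx (2 * n + 2)) (x : V) :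
    b (e i) x = e.repr x (dual i) := by
  conv_lhs => rw [← e.sum_repr x]
  rw [map_sum, Finset.sum_eq_single (dual i)]
  · have := idx_bounds i
    rw [map_smul, he.pairing, if_pos (by rw [coe_dual]; omega), smul_eq_mul, mul_one]
  · intro j _ hj
    rw [map_smul, he.pairing, if_neg, smul_zero]
    intro h
    apply hj
    apply Subtype.ext
    rw [coe_dual]
    omega
  · simp

lemma IsAdapted.apply_eq_sum (he : IsAdapted b (2 * n + 2) F e) (x y : V) :
    b x y = ∑ i, e.repr x i * e.repr y (dual i) := by
  conv_lhs => rw [← e.sum_repr x]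
  simp only [map_sum, map_smul, LinearMap.sum_apply, LinearMap.smul_apply, smul_eq_mul,
    he.apply_basis_left]

end adapted

/-! ### Eichler transformations: isometries of determinant one. -/

section eichler

variable (b : LinearMap.BilinForm ℂ V)

/-- The Eichler transformation attached to an isotropic vector `a` and a vector `y` orthogonal
to `a`. -/
noncomputable def eichler (a y : V) : V →ₗ[ℂ] V :=
  LinearMap.id + (b a).smulRight (y - (b y y / 2) • a) - (b y).smulRight a

variable {b}

lemma eichler_apply (a y v : V) :
    eichler b a y v = v + b a v • (y - (b y y / 2) • a) - b y v • a := rfl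

lemma eichler_isometry (hsymm : b.IsSymm) {a y : V} (ha : b a a = 0) (hay : b a y = 0) (v w : V) :
    b (eichler b a y v) (eichler b a y w) = b v w := by
  have hya : b y a = 0 := (LinearMap.BilinForm.IsSymm.eq hsymm y a).trans hay
  have h1 : b v a = b a v := LinearMap.BilinForm.IsSymm.eq hsymm v a
  have h2 : b v y = b y v := LinearMap.BilinForm.IsSymm.eq hsymm v y
  simp only [eichler_apply, map_add, map_sub, map_smul, LinearMap.add_apply, LinearMap.sub_apply,
    LinearMap.smul_apply, smul_eq_mul, ha, hay, hya, h1, h2]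
  ring

/-- For fixed `a` the transformations form an additive group in `y`. This provides both the inverse
(`-y`) and a square root (`y / 2`). -/
lemma eichler_comp (hsymm : b.IsSymm) {a y z : V} (ha : b a a = 0) (hay : b a y = 0)
    (haz : b a z = 0) (v : V) :
    eichler b a y (eichler b a z v) = eichler b a (y + z) v := by
  have hya : b y a = 0 := (LinearMap.BilinForm.IsSymm.eq hsymm y a).trans hay
  have h2 : b y z = b z y := LinearMap.BilinForm.IsSymm.eq hsymm y z
  simp only [eichler_apply, map_add, map_sub, map_smul, LinearMap.add_apply,
    ha, haz, hya, h2]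
  module

lemma eichler_zero (a : V) : eichler b a 0 = LinearMap.id := by
  ext v
  simp [eichler_apply]

/-- The Eichler transformation as a linear automorphism. -/
noncomputable def eichlerEquiv (hsymm : b.IsSymm) {a y : V} (ha : b a a = 0) (hay : b a y = 0) : V ≃ₗ[ℂ] V :=
  LinearEquiv.ofLinearMap (eichler b a y) (eichler b a (-y))
    (by
      ext v
      rw [LinearMap.comp_apply, eichler_comp hsymm ha hay (by simp [hay]), add_neg_cancel,
        eichler_zero])
    (by
      ext v
      rw [LinearMap.comp_apply, eichler_comp hsymm ha (by simp [hay]) hay, neg_add_cancel,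
        eichler_zero])

lemma eichlerEquiv_apply (hsymm : b.IsSymm) {a y : V} (ha : b a a = 0) (hay : b a y = 0) (v : V) :
    eichlerEquiv hsymm ha hay v = eichler b a y v := rfl

lemma det_mul_self_of_isometry {ι : Type*} [Fintype ι] [DecidableEq ι] (e : Module.Basis ι ℂ V)
    (hnondeg : b.Nondegenerate) (g : V →ₗ[ℂ] V) (hg : ∀ x y, b (g x) (g y) = b x y) :
    LinearMap.det g * LinearMap.det g = 1 := by
  have h1 : b.comp g g = b := by
    ext x y
    exact hg x y
  have h2 := LinearMap.BilinForm.toMatrix_comp e e b g g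
  rw [h1] at h2
  have h3 := congrArg Matrix.det h2
  rw [Matrix.det_mul, Matrix.det_mul, Matrix.det_transpose, LinearMap.det_toMatrix] at h3
  have h4 := (LinearMap.BilinForm.nondegenerate_iff_det_ne_zero e).1 hnondeg
  apply mul_left_cancel₀ h4
  linear_combination -h3

/-- The transformation is the square of the isometry with parameter `y / 2`, and the determinant of
an isometry squares to one. -/
lemma det_eichler {ι : Type*} [Fintype ι] [DecidableEq ι] (e : Module.Basis ι ℂ V)
    (hnondeg : b.Nondegenerate) (hsymm : b.IsSymm) {a y : V} (ha : b a a = 0) (hay : b a y = 0) :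
    LinearMap.det (eichler b a y) = 1 := by
  have hay' : b a ((1 / 2 : ℂ) • y) = 0 := by simp [hay]
  have h : eichler b a y = eichler b a ((1 / 2 : ℂ) • y) ∘ₗ eichler b a ((1 / 2 : ℂ) • y) := by
    ext v
    rw [LinearMap.comp_apply, eichler_comp hsymm ha hay' hay']
    congr 2
    module
  rw [h, LinearMap.det_comp]
  exact det_mul_self_of_isometry e hnondeg _ (eichler_isometry hsymm ha hay')

end eichler

/-! ### The Borel subgroup and the Bruhat decomposition. -/

section borel

variable {b : LinearMap.BilinForm ℂ V} {F : ℕ → Submodule ℂ V}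
  {e : Module.Basis (Idx (2 * n + 2)) ℂ V} {N : ℕ}

lemma refl_mem_borel : LinearEquiv.refl ℂ V ∈ borel b N F :=
  ⟨fun _ _ => rfl, by simp, fun p _ => by simp⟩

lemma trans_mem_borel {g h : V ≃ₗ[ℂ] V} (hg : g ∈ borel b N F) (hh : h ∈ borel b N F) :
    g.trans h ∈ borel b N F := by
  refine ⟨fun x y => ?_, ?_, fun p hp => ?_⟩
  · rw [LinearEquiv.trans_apply, LinearEquiv.trans_apply, hh.1, hg.1]
  · rw [LinearEquiv.coe_trans, LinearMap.det_comp, hg.2.1, hh.2.1, one_mul]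
  · rw [LinearEquiv.coe_trans, Submodule.map_comp, hg.2.2 p hp, hh.2.2 p hp]

lemma map_mem_OG {g : V ≃ₗ[ℂ] V} (hg : ∀ x y, b (g x) (g y) = b x y) {S : Submodule ℂ V}
    (hS : S ∈ OG b m) : S.map (g : V →ₗ[ℂ] V) ∈ OG b m := by
  refine ⟨by rw [LinearEquiv.finrank_map_eq, hS.1], ?_⟩
  rintro _ ⟨x, hx, rfl⟩ _ ⟨y, hy, rfl⟩
  exact (hg x y).trans (hS.2 x hx y hy)

/-- Since `y` involves only basis vectors below `q`, each added term with nonzero coefficient lies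
in `F p`: if `v` has a `q`-coordinate then `q ≤ p`, and a nonzero pairing with `y` forces `N + 1 -
q` below an index occurring in the other argument. -/
lemma eichler_map_flag_le (he : IsAdapted b (2 * n + 2) F e) {q : Idx (2 * n + 2)} {y : V}
    (hy : ∀ i, q ≤ i → e.repr y i = 0) {p : ℕ} (hp : p ≤ 2 * n + 2) :
    (F p).map (eichler b (e (dual q)) y) ≤ F p := by
  have hq := idx_bounds q
  rintro _ ⟨v, hv, rfl⟩
  have hv' := (he.mem_flag hp v).1 hv
  rw [eichler_apply, he.apply_basis_left, dual_dual]
  have ha : (q : ℕ) ≥ 2 * n + 3 - p → e (dual q) ∈ F p := by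
    intro h
    rw [he.mem_flag hp]
    intro i hi
    rw [repr_self_apply, if_neg]
    rintro rfl
    rw [coe_dual] at hi
    omega
  refine Submodule.sub_mem _ (Submodule.add_mem _ hv ?_) ?_
  · by_cases h0 : e.repr v q = 0
    · rw [h0, zero_smul]; exact Submodule.zero_mem _
    have hqp : (q : ℕ) ≤ p := by
      by_contra hcon
      exact h0 (hv' q (by omega))
    refine Submodule.smul_mem _ _ (Submodule.sub_mem _ ?_ ?_)
    · rw [he.mem_flag hp]
      intro i hi
      exact hy i (Subtype.coe_le_coe.1 (by omega))
    · by_cases hyy : b y y = 0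
      · rw [hyy, zero_div, zero_smul]; exact Submodule.zero_mem _
      · refine Submodule.smul_mem _ _ (ha ?_)
        by_contra hcon
        apply hyy
        rw [he.apply_eq_sum]
        refine Finset.sum_eq_zero fun i _ => ?_
        by_cases hi : q ≤ i
        · rw [hy i hi, zero_mul]
        · rw [hy (dual i), mul_zero]
          have h1 : (i : ℕ) < q := not_le.1 hi
          rw [← Subtype.coe_le_coe, coe_dual]
          omega
  · by_cases hyv : b y v = 0
    · rw [hyv, zero_smul]; exact Submodule.zero_mem _
    · refine Submodule.smul_mem _ _ (ha ?_)
      by_contra hcon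
      apply hyv
      rw [he.apply_eq_sum]
      refine Finset.sum_eq_zero fun i _ => ?_
      by_cases hi : q ≤ i
      · rw [hy i hi, zero_mul]
      · rw [hv' (dual i), mul_zero]
        have h1 : (i : ℕ) < q := not_le.1 hi
        rw [coe_dual]
        omega

lemma eichlerEquiv_mem_borel (hsymm : b.IsSymm) (hnondeg : b.Nondegenerate)
    (he : IsAdapted b (2 * n + 2) F e) {q : Idx (2 * n + 2)} {y : V}
    (hy : ∀ i, q ≤ i → e.repr y i = 0) (ha : b (e (dual q)) (e (dual q)) = 0)
    (hay : b (e (dual q)) y = 0) :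
    eichlerEquiv hsymm ha hay ∈ borel b (2 * n + 2) F := by
  refine ⟨eichler_isometry hsymm ha hay, det_eichler e hnondeg hsymm ha hay, fun p hp => ?_⟩
  apply le_antisymm
  · exact eichler_map_flag_le he hy hp
  · intro v hv
    refine ⟨(eichlerEquiv hsymm ha hay).symm v, ?_, by simp⟩
    exact eichler_map_flag_le he (y := -y) (fun i hi => by simp [hy i hi]) hp ⟨v, hv, rfl⟩

lemma IsAdapted.apply_self (he : IsAdapted b (2 * n + 2) F e) (i : Idx (2 * n + 2)) :
    b (e i) (e i) = 0 := by
  rw [he.apply_basis_left, repr_self_apply, if_neg (dual_ne_self i).symm]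

/-- The Bruhat decomposition: every point of `OG` lies in a Schubert cell. -/
lemma exists_mem_schubertCell (hsymm : b.IsSymm) (hnondeg : b.Nondegenerate)
    (he : IsAdapted b (2 * n + 2) F e) {S : Submodule ℂ V} (hS : S ∈ OG b m) :
    ∃ Q : IndexSet n m, S ∈ schubertCell b F e Q := by
  classical
  -- If `S` is not a coordinate subspace, an Eichler transformation in the Borel subgroup sends some
  -- `e q ∉ S` into `S` and fixes every `e j ∈ S`; its inverse carries `S` to a point containing
  -- more basis vectors.
  induction hd : {j | e j ∉ S}.ncard using Nat.strong_induction_on generalizing S with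
  | _ d ih =>
    subst hd
    have hle : Submodule.span ℂ (e '' {j | e j ∈ S}) ≤ S := by
      rw [Submodule.span_le]
      rintro _ ⟨j, hj, rfl⟩
      exact hj
    by_cases hST : S ≤ Submodule.span ℂ (e '' {j | e j ∈ S})
    · have heq := le_antisymm hle hST
      let T : Finset (Idx (2 * n + 2)) := Finset.univ.filter fun j => e j ∈ S
      have hT : (T : Set (Idx (2 * n + 2))) = {j | e j ∈ S} := by
        ext j; simp [T]
      let Q : IndexSet n m :=
        { carrier := T.map (Function.Embedding.subtype _)
          subset_Icc := by
            intro x hx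
            obtain ⟨j, _, rfl⟩ := Finset.mem_map.1 hx
            exact j.2
          card_eq := by
            rw [Finset.card_map, ← Set.ncard_coe_finset, hT, ← finrank_span_basis_image e, heq,
              hS.1]
          add_ne := by
            intro x hx y hy hxy
            obtain ⟨i, hi, rfl⟩ := Finset.mem_map.1 hx
            obtain ⟨j, hj, rfl⟩ := Finset.mem_map.1 hy
            have h1 := hS.2 _ (Finset.mem_filter.1 hi).2 _ (Finset.mem_filter.1 hj).2
            rw [he.pairing, if_pos (show (i : ℕ) + j = 2 * n + 2 + 1 from hxy)] at h1
            exact one_ne_zero h1 }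
      refine ⟨Q, LinearEquiv.refl ℂ V, refl_mem_borel, ?_⟩
      rw [LinearEquiv.refl_toLinearMap, Submodule.map_id]
      conv_lhs => rw [← heq]
      unfold coordSubspace
      congr 2
      ext j
      simp [Q, T]
    · obtain ⟨w, hwS, hw⟩ := Set.not_subset.1 hST
      -- remove the coordinates in `S` and normalize the leading coefficient
      let w₁ : V := w - ∑ j with e j ∈ S, e.repr w j • e j
      have hw₁S : w₁ ∈ S := Submodule.sub_mem _ hwS (Submodule.sum_mem _ fun j hj =>
        Submodule.smul_mem _ _ (Finset.mem_filter.1 hj).2)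
      have hw₁c : ∀ j, e j ∈ S → e.repr w₁ j = 0 := by
        intro j hj
        simp only [w₁, map_sub, map_sum, map_smul, Finsupp.sub_apply, Finsupp.finsetSum_apply,
          Finsupp.smul_apply, repr_self_apply, smul_eq_mul]
        rw [Finset.sum_eq_single j]
        · simp
        · intro i _ hij; rw [if_neg hij, mul_zero]
        · intro h; exact absurd (by simpa using hj) h
      have hw₁0 : e.repr w₁ ≠ 0 := by
        intro h0
        apply hw
        have h1 : w₁ = 0 := by simpa using h0
        have h2 : w = ∑ j with e j ∈ S, e.repr w j • e j := sub_eq_zero.1 h1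
        rw [h2]
        exact Submodule.sum_mem _ fun j hj => Submodule.smul_mem _ _
          (Submodule.subset_span ⟨j, (Finset.mem_filter.1 hj).2, rfl⟩)
      have hne := Finsupp.support_nonempty_iff.2 hw₁0
      obtain ⟨q, hq0, hqmax⟩ : ∃ q, e.repr w₁ q ≠ 0 ∧ ∀ i, q < i → e.repr w₁ i = 0 := by
        refine ⟨(e.repr w₁).support.max' hne,
          Finsupp.mem_support_iff.1 (Finset.max'_mem _ _), fun i hi => ?_⟩
        by_contra h0
        exact absurd (Finset.le_max' _ i (Finsupp.mem_support_iff.2 h0)) (not_le.2 hi)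
      have hqS : e q ∉ S := fun h => hq0 (hw₁c q h)
      let w₂ : V := (e.repr w₁ q)⁻¹ • w₁
      have hw₂S : w₂ ∈ S := Submodule.smul_mem _ _ hw₁S
      have hw₂q : e.repr w₂ q = 1 := by
        simp [w₂, hq0]
      have hw₂max : ∀ i, q < i → e.repr w₂ i = 0 := fun i hi => by simp [w₂, hqmax i hi]
      let y : V := w₂ - e q - e.repr w₂ (dual q) • e (dual q)
      have hycoord : ∀ i, e.repr y i = e.repr w₂ i - (if q = i then 1 else 0)
          - e.repr w₂ (dual q) * (if dual q = i then 1 else 0) := by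
        intro i
        simp only [y, map_sub, map_smul, Finsupp.sub_apply, Finsupp.smul_apply, repr_self_apply,
          smul_eq_mul]
      have hyq : e.repr y q = 0 := by
        rw [hycoord, hw₂q, if_pos rfl, if_neg (dual_ne_self q)]
        ring
      have hyq' : e.repr y (dual q) = 0 := by
        rw [hycoord, if_neg (dual_ne_self q).symm, if_pos rfl]
        ring
      have hy : ∀ i, q ≤ i → e.repr y i = 0 := by
        intro i hi
        rcases hi.eq_or_lt with rfl | hi
        · exact hyq
        · by_cases h : dual q = i
          · rw [← h]; exact hyq'
          · rw [hycoord, hw₂max i hi, if_neg hi.ne, if_neg h]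
            ring
      have ha : b (e (dual q)) (e (dual q)) = 0 := he.apply_self _
      have hay : b (e (dual q)) y = 0 := by rw [he.apply_basis_left, dual_dual, hyq]
      have hsym := LinearMap.BilinForm.IsSymm.eq hsymm
      have hE := eichlerEquiv_mem_borel hsymm hnondeg he hy ha hay
      have hw₂ : w₂ = e q + y + e.repr w₂ (dual q) • e (dual q) := by
        simp only [y]; abel
      have hbyq : b y (e q) = 0 := by rw [hsym, he.apply_basis_left, hyq']
      have hEq : eichlerEquiv hsymm ha hay (e q) = w₂ := by
        have h0 : b w₂ w₂ = 0 := hS.2 _ hw₂S _ hw₂S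
        have h1 : b (e q) (e (dual q)) = 1 := by
          rw [he.apply_basis_left, repr_self_apply, if_pos rfl]
        have h2 : b (e (dual q)) (e q) = 1 := by rw [hsym, h1]
        have h3 : b (e q) y = 0 := by rw [hsym, hbyq]
        have h4 : b y (e (dual q)) = 0 := by rw [hsym, hay]
        have h5 := he.apply_self q
        -- Isotropy of `w₂` forces its `dual q`-coordinate to be the one that the Eichler
        -- transformation produces from `e q`.
        have h6 : e.repr w₂ (dual q) = - (b y y / 2) := by
          rw [hw₂] at h0
          simp only [map_add, map_smul, LinearMap.add_apply, LinearMap.smul_apply, smul_eq_mul,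
            h1, h2, h3, h4, h5, ha, hay, hbyq] at h0
          linear_combination h0 / 2
        rw [eichlerEquiv_apply, eichler_apply, hbyq, h2, zero_smul, sub_zero, one_smul]
        conv_rhs => rw [hw₂, h6]
        module
      have hEj : ∀ j, e j ∈ S → eichlerEquiv hsymm ha hay (e j) = e j := by
        intro j hj
        have h1 : e.repr w₂ (dual j) = 0 := by
          rw [← he.apply_basis_left]
          exact hS.2 _ hj _ hw₂S
        have h2 : q ≠ j := by
          rintro rfl; exact hqS hj
        have h3 : q ≠ dual j := by
          intro h
          rw [← h, hw₂q] at h1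
          exact one_ne_zero h1
        have h4 : b (e (dual q)) (e j) = 0 := by
          rw [he.apply_basis_left, dual_dual, repr_self_apply, if_neg (Ne.symm h2)]
        have h5 : b y (e j) = 0 := by
          rw [hsym, he.apply_basis_left, hycoord, h1, if_neg h3,
            if_neg (fun h => h2 (dual_injective h))]
          ring
        rw [eichlerEquiv_apply, eichler_apply, h4, h5]
        simp
      set E := eichlerEquiv hsymm ha hay with hEdef
      have hmem : ∀ x, x ∈ S.map (E.symm : V →ₗ[ℂ] V) ↔ E x ∈ S := by
        intro x
        rw [Submodule.mem_map]
        constructor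
        · rintro ⟨z, hz, rfl⟩
          simpa using hz
        · intro h
          exact ⟨E x, h, by simp⟩
      have hS' : S.map (E.symm : V →ₗ[ℂ] V) ∈ OG b m := by
        apply map_mem_OG _ hS
        intro x z
        rw [← hE.1, E.apply_symm_apply, E.apply_symm_apply]
      obtain ⟨Q, g, hg, hgS⟩ := ih _ (by
        apply Set.ncard_lt_ncard _ (Set.toFinite _)
        refine ⟨fun j hj => ?_, fun h => ?_⟩
        · intro hjS
          apply hj
          rw [hmem, hEj j hjS]
          exact hjS
        · have := h (show q ∈ {j | e j ∉ S} from hqS)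
          apply this
          rw [hmem, hEq]
          exact hw₂S) hS' rfl
      refine ⟨Q, g.trans E, trans_mem_borel hg hE, ?_⟩
      rw [LinearEquiv.coe_trans, Submodule.map_comp, ← hgS, ← Submodule.map_comp,
        ← LinearEquiv.coe_trans, LinearEquiv.symm_trans_self, LinearEquiv.refl_toLinearMap,
        Submodule.map_id]

end borel

end EvenOG

/-! ### Limits of one-parameter families and inclusions of closures. -/

namespace EvenOG

variable {V : Type*} [AddCommGroup V] [Module ℂ V] {n m : ℕ}
  {b : LinearMap.BilinForm ℂ V} {F : ℕ → Submodule ℂ V}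
  {e : Module.Basis (Idx (2 * n + 2)) ℂ V}

lemma ncard_idx {N : ℕ} (A : Finset ℕ) : {i : Idx N | (i : ℕ) ∈ A}.ncard = cnt A N := by
  rw [cnt, ← Set.ncard_coe_finset, ← Set.ncard_image_of_injective _ Subtype.val_injective]
  congr 1
  ext x
  simp

lemma basis_mem_coordSubspace {P : IndexSet n m} {i : Idx (2 * n + 2)}
    (hi : (i : ℕ) ∈ P.carrier) : e i ∈ coordSubspace e P :=
  Submodule.subset_span ⟨i, hi, rfl⟩

lemma coordSubspace_mem_OG (he : IsAdapted b (2 * n + 2) F e) (P : IndexSet n m) :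
    coordSubspace e P ∈ OG b m := by
  refine ⟨?_, fun x hx y hy => ?_⟩
  · unfold coordSubspace
    rw [finrank_span_basis_image, ncard_idx, P.cnt_top le_rfl]
  · unfold coordSubspace at hx hy
    rw [mem_span_basis_image] at hx hy
    rw [he.apply_eq_sum]
    refine Finset.sum_eq_zero fun i _ => ?_
    by_cases hi : (i : ℕ) ∈ P.carrier
    · rw [hy _ (P.dual_notMem hi), mul_zero]
    · rw [hx _ hi, zero_mul]

lemma schubertCell_subset_OG (he : IsAdapted b (2 * n + 2) F e) (P : IndexSet n m) :
    schubertCell b F e P ⊆ OG b m := by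
  rintro _ ⟨g, hg, rfl⟩
  exact map_mem_OG hg.1 (coordSubspace_mem_OG he P)

lemma subset_zariskiClosure {N : ℕ} {e : Module.Basis (Idx N) ℂ V} {A : Set (Submodule ℂ V)}
    (hA : A ⊆ OG b m) : A ⊆ zariskiClosure b m e A :=
  fun S hS => ⟨hA hS, fun _ _ _ h => h S hS⟩

lemma zariskiClosure_subset {N : ℕ} {e : Module.Basis (Idx N) ℂ V} {A B : Set (Submodule ℂ V)}
    (h : A ⊆ zariskiClosure b m e B) : zariskiClosure b m e A ⊆ zariskiClosure b m e B :=
  fun _ hS => ⟨hS.1, fun d f hf hB => hS.2 d f hf fun _ hT => (h hT).2 d f hf hB⟩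

/-- The limit of a one-parameter family of points of `A` lies in the closure of `A`. -/
lemma mem_zariskiClosure_of_family {N : ℕ} {e : Module.Basis (Idx N) ℂ V}
    {A : Set (Submodule ℂ V)} {S : Submodule ℂ V} (hS : S ∈ OG b m) (h : ℂ → V ≃ₗ[ℂ] V)
    (h0 : ∀ v, h 0 v = v) (hcont : ∀ v i, Continuous fun t => e.repr (h t v) i)
    (hA : ∀ t, t ≠ 0 → S.map (h t : V →ₗ[ℂ] V) ∈ A) : S ∈ zariskiClosure b m e A := by
  refine ⟨hS, fun d f _ hf v hv hvS => ?_⟩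
  let φ : ℂ → ℂ := fun t => MvPolynomial.eval (plucker e fun r => h t (v r)) f
  have hφ : Continuous φ := by
    refine (MvPolynomial.continuous_eval f).comp (continuous_pi fun I => ?_)
    unfold plucker
    exact Continuous.matrix_det (continuous_matrix fun r s => hcont _ _)
  have hz : φ = fun _ => 0 := by
    refine Continuous.ext_on (dense_compl_singleton (0 : ℂ)) hφ continuous_const ?_
    intro t ht
    refine hf _ (hA t ht) _ ?_ ?_
    · exact hv.map' (h t : V →ₗ[ℂ] V) (LinearEquiv.ker _)
    · rw [← hvS, Submodule.map_span, ← Set.range_comp]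
      rfl
  have := congrFun hz 0
  simpa only [φ, h0] using this

lemma eichler_basis (he : IsAdapted b (2 * n + 2) F e) (k l i : Idx (2 * n + 2)) (s : ℂ) :
    eichler b (e (dual k)) (s • e l) (e i) =
      e i + (if i = k then s else 0) • e l - (if i = dual l then s else 0) • e (dual k) := by
  rw [eichler_apply]
  simp only [map_smul, LinearMap.smul_apply, he.apply_self, he.apply_basis_left, dual_dual,
    repr_self_apply]
  split_ifs <;> simp

/-- The opposite unipotent `e_q ↦ e_q + t e_p` and the Borel unipotent `e_p ↦ e_p + t⁻¹ e_q` (with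
their effects on the dual vectors) carry the coordinate subspaces of `R` and of `P`, respectively,
to the same subspace for `t ≠ 0`, because `t (e_p + t⁻¹ e_q) = e_q + t e_p`. -/
lemma schubertCell_subset_of_move (hsymm : b.IsSymm) (hnondeg : b.Nondegenerate)
    (he : IsAdapted b (2 * n + 2) F e) {P R : IndexSet n m} (hmove : P.Move R) :
    schubertCell b F e R ⊆ schubertVariety b F e P := by
  rintro S ⟨g, hg, rfl⟩
  obtain ⟨p, q, hq1, hqp, hpq, hp, hR⟩ := hmove
  have hbp := P.mem_bounds hp
  obtain ⟨p, rfl⟩ : ∃ p' : Idx (2 * n + 2), (p' : ℕ) = p := ⟨⟨p, P.subset_Icc hp⟩, rfl⟩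
  obtain ⟨q, rfl⟩ : ∃ q' : Idx (2 * n + 2), (q' : ℕ) = q :=
    ⟨⟨q, Finset.mem_Icc.2 ⟨hq1, by omega⟩⟩, rfl⟩
  have hne : p ≠ q := by rintro rfl; exact lt_irrefl _ hqp
  have hne' : q ≠ dual p := by
    rintro rfl
    rw [coe_dual] at hpq
    omega
  have hne'' : p ≠ dual q := fun h => hne' ((dual_eq_iff _ _).1 h.symm)
  have hay : ∀ t : ℂ, b (e (dual q)) (t • e p) = 0 := fun t => by
    rw [map_smul, he.apply_basis_left, dual_dual, repr_self_apply, if_neg hne, smul_zero]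
  have hay' : ∀ t : ℂ, b (e (dual p)) (t • e q) = 0 := fun t => by
    rw [map_smul, he.apply_basis_left, dual_dual, repr_self_apply, if_neg hne.symm, smul_zero]
  -- Conjugation by `g` transports the degeneration from the coordinate point to an arbitrary point
  -- of the cell of `R`.
  let h : ℂ → V ≃ₗ[ℂ] V := fun t =>
    (g.symm.trans (eichlerEquiv hsymm (he.apply_self _) (hay t))).trans g
  refine mem_zariskiClosure_of_family
    (schubertCell_subset_OG he R ⟨g, hg, rfl⟩) h ?_ ?_ ?_
  · intro v
    simp [h, eichlerEquiv_apply, eichler_apply]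
  · intro v i
    simp only [h, LinearEquiv.trans_apply, eichlerEquiv_apply, eichler_apply, map_add, map_sub,
      map_smul, LinearMap.smul_apply, Finsupp.add_apply, Finsupp.sub_apply, Finsupp.smul_apply,
      smul_eq_mul]
    fun_prop
  · intro t ht
    have hu : eichlerEquiv hsymm (he.apply_self _) (hay' t⁻¹) ∈ borel b (2 * n + 2) F := by
      refine eichlerEquiv_mem_borel hsymm hnondeg he (fun i hi => ?_) _ _
      rw [map_smul, Finsupp.smul_apply, repr_self_apply, if_neg, smul_zero]
      rintro rfl
      exact absurd hqp (not_lt.2 hi)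
    refine ⟨_, trans_mem_borel hu hg, ?_⟩
    rw [LinearEquiv.coe_trans, LinearEquiv.coe_trans, Submodule.map_comp, Submodule.map_comp,
      LinearEquiv.coe_trans, Submodule.map_comp, ← Submodule.map_comp (g : V →ₗ[ℂ] V),
      ← LinearEquiv.coe_trans, LinearEquiv.self_trans_symm, LinearEquiv.refl_toLinearMap,
      Submodule.map_id]
    congr 1
    have : Module.Finite ℂ V := Module.Finite.of_basis e
    apply Submodule.eq_of_le_of_finrank_eq
    · rw [Submodule.map_le_iff_le_comap, coordSubspace, Submodule.span_le]
      rintro _ ⟨i, hi, rfl⟩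
      change eichler b (e (dual q)) (t • e p) (e i) ∈
        (coordSubspace e P).map (eichlerEquiv hsymm (he.apply_self (dual p)) (hay' t⁻¹) :
          V →ₗ[ℂ] V)
      have hu' : ∀ j : Idx (2 * n + 2), (j : ℕ) ∈ P.carrier →
          eichler b (e (dual p)) (t⁻¹ • e q) (e j) ∈
          (coordSubspace e P).map (eichlerEquiv hsymm (he.apply_self (dual p)) (hay' t⁻¹) :
            V →ₗ[ℂ] V) :=
        fun j hj => ⟨e j, basis_mem_coordSubspace hj, rfl⟩
      rcases hR i hi with h1 | ⟨h1, h2⟩ | ⟨h1, h2, h3, h4, h5⟩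
      · obtain rfl : i = q := Subtype.ext h1
        have h3 := Submodule.smul_mem _ t (hu' p hp)
        rw [eichler_basis he, if_pos rfl, if_neg hne''] at h3
        rw [eichler_basis he, if_pos rfl, if_neg hne']
        convert h3 using 1
        rw [zero_smul, zero_smul, sub_zero, sub_zero, smul_add, smul_smul, mul_inv_cancel₀ ht,
          one_smul, add_comm]
      · obtain rfl : i = dual p := Subtype.ext h1
        have h3 := Submodule.smul_mem _ (-t) (hu' (dual q) h2)
        rw [eichler_basis he, if_neg hne''.symm, if_pos rfl] at h3
        rw [eichler_basis he, if_neg hne'.symm, if_pos rfl]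
        convert h3 using 1
        rw [zero_smul, zero_smul, add_zero, add_zero, smul_sub, smul_smul, neg_mul,
          mul_inv_cancel₀ ht]
        module
      · have h6 := hu' i h1
        have h2' : i ≠ p := fun h => h2 (congrArg _ h)
        have h3' : i ≠ q := fun h => h3 (congrArg _ h)
        have h4' : i ≠ dual p := fun h => h4 (congrArg _ h)
        have h5' : i ≠ dual q := fun h => h5 (congrArg _ h)
        rw [eichler_basis he, if_neg h2', if_neg h5'] at h6
        rw [eichler_basis he, if_neg h3', if_neg h4']
        simpa using h6
    · rw [LinearEquiv.finrank_map_eq, LinearEquiv.finrank_map_eq, (coordSubspace_mem_OG he P).1,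
        (coordSubspace_mem_OG he R).1]

lemma schubertVariety_subset_of_prec (hm : m < n + 1) (hsymm : b.IsSymm)
    (hnondeg : b.Nondegenerate) (he : IsAdapted b (2 * n + 2) F e) {P Q : IndexSet n m}
    (h : Q.Prec P) : schubertVariety b F e Q ⊆ schubertVariety b F e P := by
  have hr := IndexSet.reachable_of_prec hm h
  clear h
  induction hr with
  | refl => exact subset_rfl
  | tail _ hmove ih =>
    exact (zariskiClosure_subset (schubertCell_subset_of_move hsymm hnondeg he hmove)).trans
      ih

end EvenOG

/-! ### Determinants of isometries and transverse maximal isotropic subspaces. -/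

namespace EvenOG

variable {V : Type*} [AddCommGroup V] [Module ℂ V] {n m : ℕ}
  {b : LinearMap.BilinForm ℂ V} {F : ℕ → Submodule ℂ V}
  {e : Module.Basis (Idx (2 * n + 2)) ℂ V}

section parity

/-- An isometry of a split quadratic space `E ⊕ W` whose block `E → E` is invertible has
determinant one. -/
lemma det_eq_one_of_block {κ : Type*} [Fintype κ] [DecidableEq κ] (A B C D : Matrix κ κ ℂ)
    (h1 : A.transpose * C + C.transpose * A = 0) (h2 : A.transpose * D + C.transpose * B = 1)
    (hA : A.det ≠ 0) : (Matrix.fromBlocks A B C D).det = 1 := by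
  have : Invertible A := Matrix.invertibleOfIsUnitDet A (isUnit_iff_ne_zero.2 hA)
  rw [Matrix.det_fromBlocks₁₁]
  -- The isometry relations make the Schur complement inverse to the transpose of `A`, so the two
  -- determinants cancel.
  have h3 : A.transpose * (D - C * ⅟A * B) = 1 := by
    have h4 : A.transpose * C = - (C.transpose * A) := eq_neg_of_add_eq_zero_left h1
    rw [Matrix.mul_sub, ← Matrix.mul_assoc, ← Matrix.mul_assoc, h4, Matrix.neg_mul,
      Matrix.mul_assoc C.transpose, mul_invOf_self, Matrix.mul_one, Matrix.neg_mul, sub_neg_eq_add,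
      h2]
  have h5 := congrArg Matrix.det h3
  rwa [Matrix.det_mul, Matrix.det_transpose, Matrix.det_one] at h5

/-- A set of indices that contains exactly one of `i`, `N + 1 - i` for each `i`. -/
def IsLagrangian (A : Set (Idx (2 * n + 2))) : Prop := ∀ i, dual i ∈ A ↔ i ∉ A

/-- `A` and its complement split `V` into two isotropic halves in duality, and `hint` says that the
diagonal block of `g` on the first half is injective. -/
lemma det_eq_one_of_lagrangian (he : IsAdapted b (2 * n + 2) F e) {A : Set (Idx (2 * n + 2))}
    (hA : IsLagrangian A) (g : V ≃ₗ[ℂ] V) (hg : ∀ x y, b (g x) (g y) = b x y)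
    (hint : ∀ x ∈ Submodule.span ℂ (e '' A), g x ∈ Submodule.span ℂ (e '' Aᶜ) → x = 0) :
    LinearMap.det (g : V →ₗ[ℂ] V) = 1 := by
  classical
  let φ : A ⊕ A ≃ Idx (2 * n + 2) :=
    { toFun := Sum.elim (fun i => i) (fun i => dual i)
      invFun := fun i => if h : i ∈ A then Sum.inl ⟨i, h⟩ else Sum.inr ⟨dual i, (hA i).2 h⟩
      left_inv := by
        rintro (i | i)
        · simp
        · have : dual (i : Idx (2 * n + 2)) ∉ A := fun h => (hA _).1 h i.2
          simp [this, dual_dual]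
      right_inv := by
        intro i
        by_cases h : i ∈ A
        · simp [h]
        · simp [h, dual_dual] }
  have hφl : ∀ i : A, φ (Sum.inl i) = i := fun _ => rfl
  have hφr : ∀ i : A, φ (Sum.inr i) = dual i := fun _ => rfl
  let β : Module.Basis (A ⊕ A) ℂ V := e.reindex φ.symm
  have hβ : ∀ k, β k = e (φ k) := fun k => by simp [β]
  have hrepr : ∀ x k, β.repr x k = e.repr x (φ k) := fun x k => by
    simp [β]
  have hb : ∀ x y, b x y = ∑ r : A, β.repr x (Sum.inl r) * β.repr y (Sum.inr r) +
      ∑ r : A, β.repr x (Sum.inr r) * β.repr y (Sum.inl r) := by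
    intro x y
    rw [he.apply_eq_sum, ← Equiv.sum_comp φ, Fintype.sum_sum_type]
    simp only [hrepr, hφl, hφr, dual_dual]
  let M := LinearMap.toMatrix β β (g : V →ₗ[ℂ] V)
  have hM : ∀ k l, M k l = β.repr (g (β l)) k := fun k l => LinearMap.toMatrix_apply _ _ _ _ _
  have hb' : ∀ k l, ∑ r : A, M (Sum.inl r) k * M (Sum.inr r) l +
      ∑ r : A, M (Sum.inr r) k * M (Sum.inl r) l = b (β k) (β l) := by
    intro k l
    rw [← hg, hb]
    simp only [hM]
  have hβdual : ∀ i j : A, (i : Idx (2 * n + 2)) ≠ dual j := by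
    intro i j h
    exact (hA j).1 (h ▸ i.2) j.2
  rw [← LinearMap.det_toMatrix β]
  change M.det = 1
  rw [← Matrix.fromBlocks_toBlocks M]
  apply det_eq_one_of_block
  · ext i j
    have := hb' (Sum.inl i) (Sum.inl j)
    rw [hβ, hβ, he.apply_basis_left, repr_self_apply, hφl, hφl, if_neg (hβdual j i)] at this
    simpa [Matrix.mul_apply, Matrix.toBlocks₁₁, Matrix.toBlocks₂₁] using this
  · ext i j
    have := hb' (Sum.inl i) (Sum.inr j)
    rw [hβ, hβ, he.apply_basis_left, repr_self_apply, hφl, hφr] at this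
    rw [Matrix.one_apply]
    have h2 : (dual (j : Idx (2 * n + 2)) = dual (i : Idx (2 * n + 2))) ↔ i = j := by
      rw [dual_injective.eq_iff, Subtype.coe_inj, eq_comm]
    simp only [h2] at this
    rw [← this]
    simp [Matrix.mul_apply, Matrix.toBlocks₁₁, Matrix.toBlocks₂₁, Matrix.toBlocks₁₂,
      Matrix.toBlocks₂₂]
  · intro hdet
    obtain ⟨v, hv0, hv⟩ := Matrix.exists_mulVec_eq_zero_iff.2 hdet
    let x : V := ∑ i : A, v i • e i
    have hxA : x ∈ Submodule.span ℂ (e '' A) := Submodule.sum_mem _ fun i _ =>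
      Submodule.smul_mem _ _ (Submodule.subset_span ⟨i, i.2, rfl⟩)
    have hx : x = 0 := by
      apply hint x hxA
      rw [mem_span_basis_image]
      intro i hi
      have hi' : i ∈ A := not_not.1 hi
      have h1 := congrFun hv ⟨i, hi'⟩
      simp only [Matrix.mulVec, dotProduct, Matrix.toBlocks₁₁, Matrix.of_apply, hM, hrepr, hβ, hφl,
        Pi.zero_apply] at h1
      simp only [x, map_sum, map_smul, Finsupp.finsetSum_apply, Finsupp.smul_apply, smul_eq_mul]
      rw [← h1]
      exact Finset.sum_congr rfl fun r _ => mul_comm _ _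
    apply hv0
    have hli : LinearIndependent ℂ fun i : A => e i :=
      e.linearIndependent.comp _ Subtype.val_injective
    ext i
    exact Fintype.linearIndependent_iff.1 hli v hx i

/-- The isometry that interchanges `e i` and its dual basis vector. -/
noncomputable def dualSwap (e : Module.Basis (Idx (2 * n + 2)) ℂ V) (i : Idx (2 * n + 2)) :
    V ≃ₗ[ℂ] V := e.equiv e (Equiv.swap i (dual i))

lemma swap_dual (i j : Idx (2 * n + 2)) :
    Equiv.swap i (dual i) (dual j) = dual (Equiv.swap i (dual i) j) := by
  by_cases h1 : j = i
  · subst h1; simp [dual_dual]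
  by_cases h2 : j = dual i
  · subst h2; simp [dual_dual]
  rw [Equiv.swap_apply_of_ne_of_ne h1 h2, Equiv.swap_apply_of_ne_of_ne]
  · intro h; exact h2 ((dual_eq_iff _ _).1 h)
  · intro h; exact h1 (dual_injective h)

lemma dualSwap_basis (i j : Idx (2 * n + 2)) :
    dualSwap e i (e j) = e (Equiv.swap i (dual i) j) := by
  simp [dualSwap]

lemma repr_dualSwap (i j : Idx (2 * n + 2)) (x : V) :
    e.repr (dualSwap e i x) j = e.repr x (Equiv.swap i (dual i) j) := by
  conv_lhs => rw [← e.sum_repr x]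
  simp only [map_sum, map_smul, dualSwap_basis, Finsupp.finsetSum_apply, Finsupp.smul_apply,
    repr_self_apply, smul_eq_mul]
  rw [Finset.sum_eq_single (Equiv.swap i (dual i) j)]
  · simp
  · intro k _ hk
    rw [if_neg, mul_zero]
    rintro rfl
    simp at hk
  · simp

lemma dualSwap_isometry (he : IsAdapted b (2 * n + 2) F e) (i : Idx (2 * n + 2)) (x y : V) :
    b (dualSwap e i x) (dualSwap e i y) = b x y := by
  rw [he.apply_eq_sum, he.apply_eq_sum, ← Equiv.sum_comp (Equiv.swap i (dual i))]
  refine Finset.sum_congr rfl fun j _ => ?_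
  rw [repr_dualSwap, repr_dualSwap, swap_dual, Equiv.swap_apply_self]

lemma det_dualSwap (i : Idx (2 * n + 2)) :
    LinearMap.det (dualSwap e i : V →ₗ[ℂ] V) = -1 := by
  have h := Matrix.det_permute (Equiv.swap i (dual i)) (1 : Matrix (Idx (2 * n + 2)) _ ℂ)
  rw [Equiv.Perm.sign_swap (dual_ne_self i).symm, Matrix.det_one] at h
  rw [← LinearMap.det_toMatrix e]
  convert h using 1
  · congr 1
    ext j k
    rw [LinearMap.toMatrix_apply, LinearEquiv.coe_coe, repr_dualSwap, repr_self_apply,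
      Matrix.submatrix_apply, Matrix.one_apply, id]
    simp only [eq_comm]
  · simp

-- Precomposing `g` with `dualSwap e i`, of determinant `-1`, makes `A` agree with `C` at one more
-- dual pair; when `A = C` the determinant is one.
open Classical in
lemma det_eq_neg_one_pow (he : IsAdapted b (2 * n + 2) F e) {A C : Set (Idx (2 * n + 2))}
    (hA : IsLagrangian A) (hC : IsLagrangian C) (g : V ≃ₗ[ℂ] V)
    (hg : ∀ x y, b (g x) (g y) = b x y)
    (hint : ∀ x ∈ Submodule.span ℂ (e '' A), g x ∈ Submodule.span ℂ (e '' Cᶜ) → x = 0) :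
    LinearMap.det (g : V →ₗ[ℂ] V) =
      (-1) ^ (Finset.univ.filter fun i : Idx (2 * n + 2) =>
        (i : ℕ) ≤ n + 1 ∧ ¬ (i ∈ A ↔ i ∈ C)).card := by
  induction hd : (Finset.univ.filter fun i : Idx (2 * n + 2) =>
        (i : ℕ) ≤ n + 1 ∧ ¬ (i ∈ A ↔ i ∈ C)).card generalizing A g with
  | zero =>
    rw [pow_zero]
    rw [Finset.card_eq_zero, Finset.filter_eq_empty_iff] at hd
    have hAC : A = C := by
      have h1 : ∀ i : Idx (2 * n + 2), (i : ℕ) ≤ n + 1 → (i ∈ A ↔ i ∈ C) := by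
        intro i hi
        have := hd (Finset.mem_univ i)
        tauto
      ext i
      by_cases hi : (i : ℕ) ≤ n + 1
      · exact h1 i hi
      · have h2 := h1 (dual i) (by rw [coe_dual]; omega)
        rw [hA, hC] at h2
        tauto
    subst hAC
    exact det_eq_one_of_lagrangian he hA g hg hint
  | succ d ih =>
    obtain ⟨i, hi⟩ := Finset.card_pos.1 (by rw [hd]; omega)
    obtain ⟨hi1, hi2⟩ := (Finset.mem_filter.1 hi).2
    let A' : Set (Idx (2 * n + 2)) := {j | Equiv.swap i (dual i) j ∈ A}
    have hA' : IsLagrangian A' := by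
      intro j
      simp only [A', Set.mem_ofPred_eq, swap_dual]
      exact hA _
    have key := ih (A := A') hA' ((dualSwap e i).trans g)
      (fun x y => by
        rw [LinearEquiv.trans_apply, LinearEquiv.trans_apply, hg, dualSwap_isometry he])
      (fun x hx hgx => by
        have h0 : dualSwap e i x = 0 := by
          refine hint (dualSwap e i x) ?_ hgx
          rw [mem_span_basis_image] at hx ⊢
          intro j hj
          rw [repr_dualSwap]
          apply hx
          simpa [A'] using hj
        simpa using h0)
      (by
        have h3 : (Finset.univ.filter fun j : Idx (2 * n + 2) =>
            (j : ℕ) ≤ n + 1 ∧ ¬ (j ∈ A' ↔ j ∈ C)) = (Finset.univ.filter fun j : Idx (2 * n + 2) =>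
            (j : ℕ) ≤ n + 1 ∧ ¬ (j ∈ A ↔ j ∈ C)).erase i := by
          ext j
          simp only [Finset.mem_filter, Finset.mem_erase, Finset.mem_univ, true_and, A',
            Set.mem_ofPred_eq]
          by_cases hji : j = i
          · subst hji
            rw [Equiv.swap_apply_left, hA]
            tauto
          · by_cases hj : (j : ℕ) ≤ n + 1
            · rw [Equiv.swap_apply_of_ne_of_ne hji]
              · tauto
              · rintro rfl
                rw [coe_dual] at hj
                omega
            · tauto
        rw [h3, Finset.card_erase_of_mem hi, hd]
        rfl)
    rw [LinearEquiv.coe_trans, LinearMap.det_comp, det_dualSwap] at key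
    rw [pow_succ]
    linear_combination -key

lemma ncard_lagrangian_modEq (he : IsAdapted b (2 * n + 2) F e) {A C : Set (Idx (2 * n + 2))}
    (hA : IsLagrangian A) (hC : IsLagrangian C) (g : V ≃ₗ[ℂ] V)
    (hg : ∀ x y, b (g x) (g y) = b x y) (hdet : LinearMap.det (g : V →ₗ[ℂ] V) = 1)
    (hint : ∀ x ∈ Submodule.span ℂ (e '' A), g x ∈ Submodule.span ℂ (e '' Cᶜ) → x = 0) :
    {i : Idx (2 * n + 2) | (i : ℕ) ≤ n + 1 ∧ i ∈ A}.ncard ≡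
      {i : Idx (2 * n + 2) | (i : ℕ) ≤ n + 1 ∧ i ∈ C}.ncard [MOD 2] := by
  classical
  have h := det_eq_neg_one_pow he hA hC g hg hint
  rw [hdet] at h
  have heven : Even (Finset.univ.filter fun i : Idx (2 * n + 2) =>
      (i : ℕ) ≤ n + 1 ∧ ¬ (i ∈ A ↔ i ∈ C)).card := by
    by_contra hodd
    rw [Nat.not_even_iff_odd] at hodd
    rw [hodd.neg_one_pow] at h
    norm_num at h
  set X := Finset.univ.filter fun i : Idx (2 * n + 2) => (i : ℕ) ≤ n + 1 ∧ i ∈ A with hX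
  set Y := Finset.univ.filter fun i : Idx (2 * n + 2) => (i : ℕ) ≤ n + 1 ∧ i ∈ C with hY
  have hXc : {i : Idx (2 * n + 2) | (i : ℕ) ≤ n + 1 ∧ i ∈ A}.ncard = X.card := by
    rw [← Set.ncard_coe_finset, hX, Finset.coe_filter_univ]
  have hYc : {i : Idx (2 * n + 2) | (i : ℕ) ≤ n + 1 ∧ i ∈ C}.ncard = Y.card := by
    rw [← Set.ncard_coe_finset, hY, Finset.coe_filter_univ]
  have hD : (Finset.univ.filter fun i : Idx (2 * n + 2) =>
      (i : ℕ) ≤ n + 1 ∧ ¬ (i ∈ A ↔ i ∈ C)) = (X \ Y) ∪ (Y \ X) := by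
    ext i
    simp only [X, Y, Finset.mem_filter, Finset.mem_union, Finset.mem_sdiff, Finset.mem_univ,
      true_and]
    tauto
  rw [hD, Finset.card_union_of_disjoint (disjoint_sdiff_sdiff)] at heven
  have h1 := Finset.card_sdiff_add_card_inter X Y
  have h2 := Finset.card_sdiff_add_card_inter Y X
  rw [Finset.inter_comm] at h2
  rw [Nat.even_iff] at heven
  rw [hXc, hYc]
  unfold Nat.ModEq
  omega

end parity

end EvenOG

/-! ### Schubert cells against the flag and against opposite coordinate subspaces. -/

namespace EvenOG

variable {V : Type*} [AddCommGroup V] [Module ℂ V] {n m : ℕ}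
  {b : LinearMap.BilinForm ℂ V} {F : ℕ → Submodule ℂ V}
  {e : Module.Basis (Idx (2 * n + 2)) ℂ V}

lemma mem_flag_of_borel {g : V ≃ₗ[ℂ] V} (hg : g ∈ borel b (2 * n + 2) F) {p : ℕ}
    (hp : p ≤ 2 * n + 2) (x : V) : g x ∈ F p ↔ x ∈ F p := by
  constructor
  · intro h
    rw [← hg.2.2 p hp] at h
    obtain ⟨y, hy, hxy⟩ := h
    rwa [← g.injective hxy]
  · intro h
    rw [← hg.2.2 p hp]
    exact ⟨x, h, rfl⟩

lemma map_inf_flag {g : V ≃ₗ[ℂ] V} (hg : g ∈ borel b (2 * n + 2) F) {p : ℕ}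
    (hp : p ≤ 2 * n + 2) (S : Submodule ℂ V) :
    S.map (g : V →ₗ[ℂ] V) ⊓ F p = (S ⊓ F p).map (g : V →ₗ[ℂ] V) := by
  rw [Submodule.map_inf _ g.injective, hg.2.2 p hp]

lemma ncard_idx_le (A : Finset ℕ) {k : ℕ} (hk : k ≤ 2 * n + 2) :
    {i : Idx (2 * n + 2) | (i : ℕ) ∈ A ∧ (i : ℕ) ≤ k}.ncard = cnt A k := by
  rw [cnt, ← Set.ncard_coe_finset, ← Set.ncard_image_of_injective _ Subtype.val_injective]
  congr 1
  ext x
  simp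
  grind

/-- The dimension of the intersection of a point of a Schubert cell with a member of the flag. -/
lemma finrank_inf_flag (he : IsAdapted b (2 * n + 2) F e) (Q : IndexSet n m)
    {g : V ≃ₗ[ℂ] V} (hg : g ∈ borel b (2 * n + 2) F) {k : ℕ} (hk : k ≤ 2 * n + 2) :
    Module.finrank ℂ ((coordSubspace e Q).map (g : V →ₗ[ℂ] V) ⊓ F k : Submodule ℂ V) =
      cnt Q.carrier k := by
  rw [map_inf_flag hg hk, LinearEquiv.finrank_map_eq, he.flag k hk, coordSubspace,
    span_basis_image_inf, finrank_span_basis_image, ← ncard_idx_le (n := n) Q.carrier hk]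
  rfl

lemma ncard_Icc_union (Q : IndexSet n m) {c : ℕ} (hc1 : 1 ≤ c) (hc : c ≤ n + 1) :
    {i : Idx (2 * n + 2) | (i : ℕ) ≤ n + 1 ∧ ((i : ℕ) < c ∨ (i : ℕ) ∈ Q.carrier)}.ncard =
      c - 1 + Q.count c (n + 1) := by
  have h : {i : Idx (2 * n + 2) | (i : ℕ) ≤ n + 1 ∧ ((i : ℕ) < c ∨ (i : ℕ) ∈ Q.carrier)} =
      {i : Idx (2 * n + 2) | (i : ℕ) ∈
        Finset.Icc 1 (c - 1) ∪ (Q.carrier ∩ Finset.Icc c (n + 1))} := by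
    ext i
    have := idx_bounds i
    simp only [Set.mem_ofPred_eq, Finset.mem_union, Finset.mem_inter, Finset.mem_Icc]
    by_cases h : (i : ℕ) ∈ Q.carrier
    · simp only [h, or_true, and_true, true_and]; omega
    · simp only [h, or_false, false_and]; omega
  rw [h, ncard_idx, cnt, Finset.inter_eq_left.2]
  · rw [Finset.card_union_of_disjoint]
    · simp [IndexSet.count]
    · rw [Finset.disjoint_left]
      intro x hx hy
      simp only [Finset.mem_inter, Finset.mem_Icc] at hx hy
      omega
  · intro x hx
    simp only [Finset.mem_union, Finset.mem_inter, Finset.mem_Icc] at hx ⊢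
    omega

lemma finrank_sup_inf_flag (he : IsAdapted b (2 * n + 2) F e) (Q : IndexSet n m)
    {g : V ≃ₗ[ℂ] V} (hg : g ∈ borel b (2 * n + 2) F) {c : ℕ} (hc1 : 1 ≤ c) (hc : c ≤ n + 1) :
    Module.finrank ℂ (((coordSubspace e Q).map (g : V →ₗ[ℂ] V) ⊔ F (c - 1)) ⊓ F (n + 1) :
      Submodule ℂ V) = c - 1 + Q.count c (n + 1) := by
  rw [← hg.2.2 (c - 1) (by omega), ← Submodule.map_sup, map_inf_flag hg (by omega),
    LinearEquiv.finrank_map_eq, he.flag (c - 1) (by omega), he.flag (n + 1) (by omega),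
    coordSubspace, span_basis_image_sup, span_basis_image_inf, finrank_span_basis_image,
    ← ncard_Icc_union Q hc1 hc]
  congr 1
  ext i
  simp only [Set.mem_inter_iff, Set.mem_union, Set.mem_ofPred_eq]
  have : (i : ℕ) ≤ c - 1 ↔ (i : ℕ) < c := by omega
  rw [this]
  tauto

lemma IsAdapted.finrank_flag (he : IsAdapted b (2 * n + 2) F e) {k : ℕ} (hk : k ≤ 2 * n + 2) :
    Module.finrank ℂ (F k) = k := by
  have h := ncard_idx_le (n := n) (Finset.Icc 1 k) hk
  rw [cnt, Finset.inter_self, Nat.card_Icc, add_tsub_cancel_right] at h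
  rw [he.flag k hk, finrank_span_basis_image]
  conv_rhs => rw [← h]
  congr 1
  ext i
  have := idx_bounds i
  simp only [Set.mem_ofPred_eq, Finset.mem_Icc]
  omega

/-- A point of the Schubert cell of `Q` meets the coordinate subspace opposite to `Q` trivially. -/
lemma eq_zero_of_mem_opposite (he : IsAdapted b (2 * n + 2) F e) (Q : IndexSet n m)
    {g : V ≃ₗ[ℂ] V} (hg : g ∈ borel b (2 * n + 2) F) {x : V} (hx : x ∈ coordSubspace e Q)
    (hgx : g x ∈ Submodule.span ℂ (e '' {i | (i : ℕ) ∉ Q.carrier})) : x = 0 := by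
  by_contra h0
  have hne : (e.repr x).support.Nonempty := by
    rw [Finsupp.support_nonempty_iff]
    simpa using h0
  let q := (e.repr x).support.max' hne
  have hq0 : e.repr x q ≠ 0 := Finsupp.mem_support_iff.1 (Finset.max'_mem _ _)
  have hqmax : ∀ i, q < i → e.repr x i = 0 := by
    intro i hi
    by_contra h1
    exact absurd (Finset.le_max' _ i (Finsupp.mem_support_iff.2 h1)) (not_le.2 hi)
  have hb := idx_bounds q
  unfold coordSubspace at hx
  rw [mem_span_basis_image] at hx hgx
  have hqQ : (q : ℕ) ∈ Q.carrier := by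
    by_contra h1
    exact hq0 (hx q h1)
  have h1 : x ∈ F q := (he.mem_flag hb.2 x).2 fun i hi => hqmax i hi
  have h2 := (he.mem_flag hb.2 _).1 ((mem_flag_of_borel hg hb.2 x).2 h1)
  -- A Borel element preserves the leading index `q` of `x`. As `q ∈ Q`, the opposite subspace has
  -- no such coordinate, so `g x` drops to `F (q - 1)`, and hence so does `x`.
  have h3 : g x ∈ F (q - 1) := by
    rw [he.mem_flag (by omega)]
    intro i hi
    by_cases hiq : i = q
    · subst hiq
      exact hgx _ (not_not.2 hqQ)
    · have : (i : ℕ) ≠ q := fun h => hiq (Subtype.ext h)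
      exact h2 i (by omega)
  rw [mem_flag_of_borel hg (by omega), he.mem_flag (by omega)] at h3
  exact hq0 (h3 q (by omega))

/-- The sum of the dimensions of the intersections with `F k` of a point of the cell of `P` and of
the subspace opposite to `Q`. -/
lemma finrank_sup_opposite (he : IsAdapted b (2 * n + 2) F e) {P Q : IndexSet n m} {g : V ≃ₗ[ℂ] V}
    (hg : g ∈ borel b (2 * n + 2) F)
    (hint : ∀ x ∈ coordSubspace e P,
      g x ∈ Submodule.span ℂ (e '' {i | (i : ℕ) ∉ Q.carrier}) → x = 0)
    {k : ℕ} (hk : k ≤ 2 * n + 2) :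
    Module.finrank ℂ (((coordSubspace e P).map (g : V →ₗ[ℂ] V) ⊓ F k) ⊔
      (Submodule.span ℂ (e '' {i | (i : ℕ) ∉ Q.carrier}) ⊓ F k) : Submodule ℂ V) +
      cnt Q.carrier k = cnt P.carrier k + k := by
  have : Module.Finite ℂ V := Module.Finite.of_basis e
  have h1 := Submodule.finrank_sup_add_finrank_inf_eq
    ((coordSubspace e P).map (g : V →ₗ[ℂ] V) ⊓ F k)
    (Submodule.span ℂ (e '' {i | (i : ℕ) ∉ Q.carrier}) ⊓ F k)
  have h2 : ((coordSubspace e P).map (g : V →ₗ[ℂ] V) ⊓ F k) ⊓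
      (Submodule.span ℂ (e '' {i | (i : ℕ) ∉ Q.carrier}) ⊓ F k) = ⊥ := by
    rw [eq_bot_iff]
    rintro _ ⟨⟨⟨x, hx, rfl⟩, _⟩, h3, _⟩
    rw [hint x hx h3]
    simp
  have h3 : Module.finrank ℂ (Submodule.span ℂ (e '' {i | (i : ℕ) ∉ Q.carrier}) ⊓ F k :
      Submodule ℂ V) + cnt Q.carrier k = k := by
    have h4 : {i : Idx (2 * n + 2) | (i : ℕ) ∉ Q.carrier} ∩ {i | (i : ℕ) ≤ k} =
        {i : Idx (2 * n + 2) | (i : ℕ) ∈ Finset.Icc 1 k \ Q.carrier ∧ (i : ℕ) ≤ k} := by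
      ext i
      have := idx_bounds i
      simp
      grind
    rw [he.flag k hk, span_basis_image_inf, finrank_span_basis_image, h4, ncard_idx_le _ hk]
    have h5 : (Finset.Icc 1 k \ Q.carrier) ∩ Finset.Icc 1 k = Finset.Icc 1 k \ Q.carrier :=
      Finset.inter_eq_left.2 Finset.sdiff_subset
    have h6 := Finset.card_sdiff_add_card_inter (Finset.Icc 1 k) Q.carrier
    rw [Finset.inter_comm, Nat.card_Icc] at h6
    unfold cnt
    rw [h5]
    omega
  rw [h2, finrank_bot, add_zero, finrank_inf_flag he P hg hk] at h1
  omega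

/-- Inside `F k`, two subspaces of dimensions `cnt P k` and `k - cnt Q k` meet trivially, so these
dimensions add up to at most `k`. -/
lemma le_of_opposite (he : IsAdapted b (2 * n + 2) F e) {P Q : IndexSet n m} {g : V ≃ₗ[ℂ] V}
    (hg : g ∈ borel b (2 * n + 2) F)
    (hint : ∀ x ∈ coordSubspace e P,
      g x ∈ Submodule.span ℂ (e '' {i | (i : ℕ) ∉ Q.carrier}) → x = 0) : Q.Le P := by
  rw [IndexSet.le_iff_cnt]
  intro k
  by_cases hk : k ≤ 2 * n + 2
  · have : Module.Finite ℂ V := Module.Finite.of_basis e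
    have h1 := finrank_sup_opposite he hg hint hk
    have h2 := Submodule.finrank_mono (R := ℂ)
      (show ((coordSubspace e P).map (g : V →ₗ[ℂ] V) ⊓ F k) ⊔
        (Submodule.span ℂ (e '' {i | (i : ℕ) ∉ Q.carrier}) ⊓ F k) ≤ F k from
        sup_le inf_le_right inf_le_right)
    have h3 := he.finrank_flag hk
    omega
  · rw [P.cnt_top (by omega), Q.cnt_top (by omega)]

/-- The Lagrangian index set obtained from `P` and an index `c` with `[c, n + 1] ⊆ [P]`. -/
lemma isLagrangian_of_sym (P : IndexSet n m) {c : ℕ} (hc2 : c ≤ n + 1)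
    (hP : ∀ x, c ≤ x → x ≤ n + 1 → x ∈ P.carrier ∨ 2 * n + 3 - x ∈ P.carrier) :
    IsLagrangian {i : Idx (2 * n + 2) | (i : ℕ) < c ∨
      ((i : ℕ) ≤ 2 * n + 3 - c ∧ (i : ℕ) ∈ P.carrier)} := by
  intro i
  have hi := idx_bounds i
  simp only [Set.mem_ofPred_eq, coe_dual]
  have h1 : (i : ℕ) ∈ P.carrier → 2 * n + 3 - i ∉ P.carrier := P.dual_notMem
  have h2 : c ≤ i → (i : ℕ) ≤ 2 * n + 3 - c →
      (i : ℕ) ∈ P.carrier ∨ 2 * n + 3 - i ∈ P.carrier := by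
    intro h3 h4
    by_cases h5 : (i : ℕ) ≤ n + 1
    · exact hP i h3 h5
    · have := hP (2 * n + 3 - i) (by omega) (by omega)
      rw [show 2 * n + 3 - (2 * n + 3 - (i : ℕ)) = i by omega] at this
      tauto
  by_cases a1 : (i : ℕ) ∈ P.carrier <;> by_cases a2 : 2 * n + 3 - (i : ℕ) ∈ P.carrier <;>
    simp only [a1, a2, not_true, not_false_iff, or_false, or_true, and_true, and_false,
      imp_false, true_imp_iff] at h1 h2 ⊢ <;> omega

lemma ncard_lagrangian (P : IndexSet n m) {c : ℕ} (hc1 : 1 ≤ c) (hc2 : c ≤ n + 1) :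
    {i : Idx (2 * n + 2) | (i : ℕ) ≤ n + 1 ∧
      i ∈ {i : Idx (2 * n + 2) | (i : ℕ) < c ∨
        ((i : ℕ) ≤ 2 * n + 3 - c ∧ (i : ℕ) ∈ P.carrier)}}.ncard = c - 1 + P.count c (n + 1) := by
  rw [← ncard_Icc_union P hc1 hc2]
  congr 1
  ext i
  simp only [Set.mem_ofPred_eq]
  have : (i : ℕ) ≤ n + 1 → (i : ℕ) ≤ 2 * n + 3 - c := by omega
  tauto

/-- At a critical index `c`, adjoining `[1, c - 1]` to the part of `P` (or `Q`) in `[c, N + 1 - c]`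
gives a Lagrangian index set. The transversality in `hint` passes to these Lagrangians, and `det g =
1` then equates the parities of their parts in `[1, n + 1]`. -/
lemma type_eq_of_opposite (he : IsAdapted b (2 * n + 2) F e) {P Q : IndexSet n m} {g : V ≃ₗ[ℂ] V}
    (hg : g ∈ borel b (2 * n + 2) F)
    (hint : ∀ x ∈ coordSubspace e P,
      g x ∈ Submodule.span ℂ (e '' {i | (i : ℕ) ∉ Q.carrier}) → x = 0)
    (hcrit : Q.Critical P) : Q.type = P.type := by
  classical
  have : Module.Finite ℂ V := Module.Finite.of_basis e
  rw [IndexSet.type_eq_iff P Q hcrit.type_ne_zero.2 hcrit.type_ne_zero.1]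
  obtain ⟨c, hc1, hc2, hP, hQ, hPQ⟩ := (IndexSet.critical_iff Q P).1 hcrit
  have hle : c - 1 ≤ 2 * n + 2 := by omega
  have hle' : 2 * n + 3 - c ≤ 2 * n + 2 := by omega
  -- `F (c - 1)` is spanned by its intersections with the two subspaces
  have hF : ((coordSubspace e P).map (g : V →ₗ[ℂ] V) ⊓ F (c - 1)) ⊔
      (Submodule.span ℂ (e '' {i | (i : ℕ) ∉ Q.carrier}) ⊓ F (c - 1)) = F (c - 1) := by
    apply Submodule.eq_of_le_of_finrank_eq (sup_le inf_le_right inf_le_right)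
    have h1 := finrank_sup_opposite he hg hint hle
    have h2 := he.finrank_flag hle
    omega
  have hmod := ncard_lagrangian_modEq he (isLagrangian_of_sym P hc2 hP)
    (isLagrangian_of_sym Q hc2 hQ) g hg.1 hg.2.1 (by
      intro x hx hgx
      have hxc := (mem_span_basis_image _ _ _).1 hx
      have hgxc := (mem_span_basis_image _ _ _).1 hgx
      -- split `x` into a part in `F (c - 1)` and a part in the coordinate subspace of `P`
      obtain ⟨x₁, hx₁, x₂, hx₂, rfl⟩ : ∃ x₁ ∈ F (c - 1), ∃ x₂ ∈ coordSubspace e P,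
          x₁ + x₂ = x := by
        rw [← Submodule.mem_sup, he.flag _ hle, coordSubspace, span_basis_image_sup,
          mem_span_basis_image]
        intro i hi
        apply hxc
        simp only [Set.mem_union, Set.mem_ofPred_eq, not_or, not_and] at hi ⊢
        exact ⟨by omega, fun _ => hi.2⟩
      have hgx₁ := (mem_flag_of_borel hg hle x₁).2 hx₁
      rw [← hF] at hgx₁
      obtain ⟨_, ⟨⟨s, hs, rfl⟩, hs'⟩, z, ⟨hz, hz'⟩, hsz⟩ := Submodule.mem_sup.1 hgx₁
      have hzc := (mem_span_basis_image _ _ _).1 hz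
      have hz'c := (he.mem_flag hle z).1 hz'
      have hxF : x₁ + x₂ ∈ F (2 * n + 3 - c) := by
        rw [he.mem_flag hle']
        intro i hi
        apply hxc
        simp only [Set.mem_ofPred_eq, not_or, not_and]
        exact ⟨by omega, fun h => by omega⟩
      have hgxF := (he.mem_flag hle' _).1 ((mem_flag_of_borel hg hle' _).2 hxF)
      have hsum : g (x₂ + s) = g (x₁ + x₂) - z := by
        have hsz' : g s + z = g x₁ := hsz
        rw [map_add, map_add, ← hsz']
        abel
      -- With `g x₁ = g s + z`, the vector `g (x₂ + s) = g x - z` lies in the subspace opposite to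
      -- `Q`: up to `N + 1 - c` by the hypothesis on `g x`, and beyond because `x` lies in `F (N + 1
      -- - c)`.
      have h0 : x₂ + s = 0 := by
        apply hint _ (Submodule.add_mem _ hx₂ hs)
        rw [hsum, mem_span_basis_image]
        intro i hi
        rw [map_sub, Finsupp.sub_apply, hzc i hi, sub_zero]
        by_cases hi2 : (i : ℕ) ≤ 2 * n + 3 - c
        · apply hgxc
          simp only [Set.mem_compl_iff, Set.mem_ofPred_eq, not_not]
          exact Or.inr ⟨hi2, not_not.1 hi⟩
        · exact hgxF i (by omega)
      rw [h0, map_zero] at hsum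
      have hgz : g (x₁ + x₂) = z := (sub_eq_zero.1 hsum.symm)
      have hz0 : z = 0 := by
        apply e.repr.injective
        ext i
        rw [map_zero, Finsupp.zero_apply]
        by_cases hi : (i : ℕ) < c
        · rw [← hgz]
          apply hgxc
          simp only [Set.mem_compl_iff, Set.mem_ofPred_eq, not_not]
          exact Or.inl hi
        · exact hz'c i (by omega)
      rw [hz0] at hgz
      exact (LinearEquiv.map_eq_zero_iff g).1 hgz)
  rw [ncard_lagrangian P hc1 hc2, ncard_lagrangian Q hc1 hc2] at hmod
  have h8 := P.count_add hc1 (show c ≤ n + 1 + 1 by omega)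
  have h9 := Q.count_add hc1 (show c ≤ n + 1 + 1 by omega)
  unfold Nat.ModEq at hmod ⊢
  omega

/-! ### Plücker coordinates separate `X_P` from the cells with `Q ⋠ P`. -/

section plucker

/-- The elements of `Q` as a sequence of indices. -/
def IndexSet.seq (Q : IndexSet n m) (j : Fin m) : Idx (2 * n + 2) :=
  ⟨Q.elt j, Q.subset_Icc (Finset.orderEmbOfFin_mem _ _ _)⟩

lemma IndexSet.exists_seq (Q : IndexSet n m) {i : Idx (2 * n + 2)} (hi : (i : ℕ) ∈ Q.carrier) :
    ∃ j, Q.seq j = i := by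
  have h : (i : ℕ) ∈ Set.range (Q.carrier.orderEmbOfFin Q.card_eq) := by
    rw [Finset.range_orderEmbOfFin]; exact hi
  obtain ⟨j, hj⟩ := h
  exact ⟨j, Subtype.ext hj⟩

/-- A Plücker coordinate vanishes exactly at the subspaces that meet the opposite coordinate
subspace. -/
lemma plucker_eq_zero_iff (Q : IndexSet n m) {v : Fin m → V} (hv : LinearIndependent ℂ v) :
    plucker e v Q.seq = 0 ↔ ∃ x ∈ Submodule.span ℂ (Set.range v), x ≠ 0 ∧
      x ∈ Submodule.span ℂ (e '' {i | (i : ℕ) ∉ Q.carrier}) := by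
  have hcoord : ∀ (c : Fin m → ℂ) (s : Fin m),
      e.repr (∑ r, c r • v r) (Q.seq s) =
        Matrix.vecMul c (Matrix.of fun r s : Fin m => e.repr (v r) (Q.seq s)) s := by
    intro c s
    simp [Matrix.vecMul, dotProduct, Finsupp.finsetSum_apply]
  unfold plucker
  rw [← Matrix.exists_vecMul_eq_zero_iff]
  constructor
  · rintro ⟨c, hc0, hc⟩
    refine ⟨∑ r, c r • v r, Submodule.sum_mem _ fun r _ => Submodule.smul_mem _ _
      (Submodule.subset_span ⟨r, rfl⟩), fun h => ?_, ?_⟩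
    · exact hc0 (funext (Fintype.linearIndependent_iff.1 hv c h))
    · rw [mem_span_basis_image]
      intro i hi
      obtain ⟨j, rfl⟩ := Q.exists_seq (not_not.1 hi)
      rw [hcoord, hc, Pi.zero_apply]
  · rintro ⟨x, hx, hx0, hxQ⟩
    obtain ⟨c, rfl⟩ := (Submodule.mem_span_range_iff_exists_fun ℂ).1 hx
    refine ⟨c, ?_, ?_⟩
    · rintro rfl
      simp at hx0
    · ext s
      rw [← hcoord, Pi.zero_apply]
      exact (mem_span_basis_image _ _ _).1 hxQ _
        (not_not.2 (Finset.orderEmbOfFin_mem _ _ _))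

/-- The Schubert variety of `P` only meets the cells of index sets `Q ⪯ P`. -/
lemma prec_of_mem_schubertVariety (he : IsAdapted b (2 * n + 2) F e) {P Q : IndexSet n m}
    {S : Submodule ℂ V} (hSQ : S ∈ schubertCell b F e Q) (hSP : S ∈ schubertVariety b F e P) :
    Q.Prec P := by
  have : Module.Finite ℂ V := Module.Finite.of_basis e
  by_contra hprec
  -- If `Q ⋠ P`, the single linear form given by the Plücker coordinate of `Q` vanishes on the cell
  -- of `P`, hence on its closure, but it vanishes nowhere on the cell of `Q`.
  have hvan := hSP.2 1 (MvPolynomial.X Q.seq) (MvPolynomial.isHomogeneous_X _ _) (by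
    rintro T ⟨g, hg, rfl⟩ v hv hvT
    rw [MvPolynomial.eval_X]
    by_contra hne
    rw [plucker_eq_zero_iff Q hv] at hne
    have hint : ∀ x ∈ coordSubspace e P,
        g x ∈ Submodule.span ℂ (e '' {i | (i : ℕ) ∉ Q.carrier}) → x = 0 := by
      intro x hx hgx
      by_contra hx0
      refine hne ⟨g x, ?_, ?_, hgx⟩
      · rw [hvT]; exact ⟨x, hx, rfl⟩
      · simpa using hx0
    exact hprec ⟨le_of_opposite he hg hint, type_eq_of_opposite he hg hint⟩)
  obtain ⟨g, hg, rfl⟩ := hSQ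
  let B := Module.finBasisOfFinrankEq ℂ _ hSP.1.1
  let v : Fin m → V := fun r => (B r : V)
  have hv : LinearIndependent ℂ v := B.linearIndependent.map' (Submodule.subtype _)
    (Submodule.ker_subtype _)
  have hvS : Submodule.span ℂ (Set.range v) = (coordSubspace e Q).map (g : V →ₗ[ℂ] V) := by
    have h1 : Set.range v = Submodule.subtype _ '' Set.range B := by
      rw [← Set.range_comp]; rfl
    rw [h1, ← Submodule.map_span, B.span_eq, Submodule.map_subtype_top]
  have h := hvan v hv hvS
  rw [MvPolynomial.eval_X, plucker_eq_zero_iff Q hv, hvS] at h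
  obtain ⟨_, ⟨x, hx, rfl⟩, hx0, hxQ⟩ := h
  apply hx0
  rw [eq_zero_of_mem_opposite he Q hg hx hxQ, map_zero]

end plucker

lemma mem_schubertVariety_iff (hm : m < n + 1) (hsymm : b.IsSymm) (hnondeg : b.Nondegenerate)
    (he : IsAdapted b (2 * n + 2) F e) {P Q : IndexSet n m} {S : Submodule ℂ V}
    (hS : S ∈ schubertCell b F e Q) : S ∈ schubertVariety b F e P ↔ Q.Prec P :=
  ⟨prec_of_mem_schubertVariety he hS, fun h =>
    schubertVariety_subset_of_prec hm hsymm hnondeg he h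
      (subset_zariskiClosure (schubertCell_subset_OG he Q) hS)⟩

lemma mem_schubertY_iff (he : IsAdapted b (2 * n + 2) F e) {P Q : IndexSet n m}
    {S : Submodule ℂ V} (hS : S ∈ schubertCell b F e Q) : S ∈ schubertY b F P ↔
      ∀ k, k ≠ n + 1 → cnt P.carrier k ≤ cnt Q.carrier k := by
  rw [← IndexSet.barElt_iff_cnt]
  have hOG := schubertCell_subset_OG he Q hS
  obtain ⟨g, hg, rfl⟩ := hS
  have hbar : ∀ j, P.barElt j ≤ 2 * n + 2 := by
    intro j
    have := P.mem_bounds (Finset.orderEmbOfFin_mem P.carrier P.card_eq j)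
    change 1 ≤ P.elt j ∧ P.elt j ≤ _ at this
    unfold IndexSet.barElt
    split_ifs <;> omega
  simp only [schubertY, Set.mem_ofPred_eq, finrank_inf_flag he Q hg (hbar _), hOG, true_and]

lemma parityConditions_iff (he : IsAdapted b (2 * n + 2) F e) {P Q : IndexSet n m}
    {S : Submodule ℂ V} (hS : S ∈ schubertCell b F e Q) : ParityConditions F P S ↔
      ∀ c : ℕ, 1 ≤ c → c ≤ n + 1 → Finset.Icc c (n + 1) ⊆ P.sym →
        P.count 1 (c - 1) < cnt Q.carrier (c - 1) ∨
        c - 1 + Q.count c (n + 1) ≡ c - 1 + P.count c (n + 1) [MOD 2] := by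
  obtain ⟨g, hg, rfl⟩ := hS
  unfold ParityConditions
  refine forall_congr' fun c => forall_congr' fun hc1 => forall_congr' fun hc2 => ?_
  rw [finrank_inf_flag he Q hg (by omega), finrank_sup_inf_flag he Q hg hc1 hc2]

end EvenOG

/-! ### Comparison on each cell. -/

theorem mainTheorem11 {V : Type*} [AddCommGroup V] [Module ℂ V] (n m : ℕ) (hm : m < n + 1)
    (b : LinearMap.BilinForm ℂ V) (hsymm : b.IsSymm) (hnondeg : b.Nondegenerate)
    (F : ℕ → Submodule ℂ V) (hF : EvenOG.IsIsotropicFlag b (2 * n + 2) F)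
    (e : Module.Basis (EvenOG.Idx (2 * n + 2)) ℂ V)
    (he : EvenOG.IsAdapted b (2 * n + 2) F e) :
    (∀ P : EvenOG.IndexSet n m,
      EvenOG.schubertVariety b F e P =
        {S | S ∈ EvenOG.schubertY b F P ∧ EvenOG.ParityConditions F P S}) ∧
    (∀ P : EvenOG.IndexSet n m, P.type = 0 →
      EvenOG.schubertVariety b F e P = EvenOG.schubertY b F P) ∧
    (∀ P : EvenOG.IndexSet n m, 0 < P.type →
      EvenOG.schubertVariety b F e P ∪ EvenOG.schubertVariety b F e P.iota =
        EvenOG.schubertY b F P) ∧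
    (∀ P Q : EvenOG.IndexSet n m,
      EvenOG.schubertVariety b F e Q ⊆ EvenOG.schubertVariety b F e P ↔ Q.Prec P) := by
  open EvenOG in
  -- it suffices to compare subsets of `OG` on each Schubert cell
  have ext_cells : ∀ X Y : Set (Submodule ℂ V), X ⊆ OG b m → Y ⊆ OG b m →
      (∀ (Q : IndexSet n m), ∀ S ∈ schubertCell b F e Q, S ∈ X ↔ S ∈ Y) → X = Y := by
    intro X Y hX hY h
    ext S
    constructor <;> intro hS
    · obtain ⟨Q, hQ⟩ := exists_mem_schubertCell hsymm hnondeg he (hX hS)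
      exact (h Q S hQ).1 hS
    · obtain ⟨Q, hQ⟩ := exists_mem_schubertCell hsymm hnondeg he (hY hS)
      exact (h Q S hQ).2 hS
  have hX : ∀ P : IndexSet n m, schubertVariety b F e P ⊆ OG b m := fun P S hS => hS.1
  have hY : ∀ P : IndexSet n m, schubertY b F P ⊆ OG b m := fun P S hS => hS.1
  refine ⟨fun P => ?_, fun P hP => ?_, fun P hP => ?_, fun P Q => ?_⟩
  · refine ext_cells _ _ (hX P) (fun S hS => hY P hS.1) fun Q S hS => ?_
    rw [mem_schubertVariety_iff hm hsymm hnondeg he hS, Set.mem_ofPred_eq,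
      mem_schubertY_iff he hS, parityConditions_iff he hS, IndexSet.prec_iff_parity]
  · refine ext_cells _ _ (hX P) (hY P) fun Q S hS => ?_
    rw [mem_schubertVariety_iff hm hsymm hnondeg he hS, mem_schubertY_iff he hS,
      IndexSet.prec_iff_parity, and_iff_left]
    -- The parity conditions are vacuous for type `0`: any admissible `c` would put `n + 1` in
    -- `[P]`.
    intro c _ hc hsub
    rw [IndexSet.type_eq_zero_iff] at hP
    have := (IndexSet.Icc_subset_sym_iff P (n + 1) (by omega)).1
      ((Finset.Icc_subset_Icc_left hc).trans hsub) (n + 1) le_rfl le_rfl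
    rw [show 2 * n + 3 - (n + 1) = n + 2 by omega] at this
    tauto
  · refine ext_cells _ _ (Set.union_subset (hX P) (hX _)) (hY P) fun Q S hS => ?_
    rw [Set.mem_union, mem_schubertVariety_iff hm hsymm hnondeg he hS,
      mem_schubertVariety_iff hm hsymm hnondeg he hS, mem_schubertY_iff he hS]
    constructor
    · rintro (h | h) k hk
      · exact (IndexSet.le_iff_cnt _ _).1 h.1 k
      · rw [← P.cnt_iota hk]
        exact (IndexSet.le_iff_cnt _ _).1 h.1 k
    · intro h
      exact IndexSet.prec_or_prec_iota Q P h (by omega)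
  · constructor
    · intro h
      have hQ : coordSubspace e Q ∈ schubertCell b F e Q :=
        ⟨LinearEquiv.refl ℂ V, refl_mem_borel, by
          rw [LinearEquiv.refl_toLinearMap, Submodule.map_id]⟩
      exact prec_of_mem_schubertVariety he hQ
        (h (subset_zariskiClosure (schubertCell_subset_OG he Q) hQ))
    · exact schubertVariety_subset_of_prec hm hsymm hnondeg he
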